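/- **Theorem 4.1.** Let $U>0$ and $\lambda=U\pi\left(\frac{3}{4\pi}\right)^{2/3}$. Let $G$ be a finite nonnegative Borel measure on $[0,\infty)$ (in particular, any probability measure) with $\int_{[0,\infty)}v^{\frac53+\theta}\,G(dv)<\infty$ for some $\theta>0$. Let $F=(F(\cdot,t))_{t\ge 0}$ be a weak solution, starting from a probability measure on $[0,\infty)$, of $$\partial_tF(V,t)=\lambda\left(\int_0^V G(v)\big((V-v)^{\frac13}+v^{\frac13}\big)^2F(V-v,t)\,dv-\int_0^\infty G(v)\big(V^{\frac13}+v^{\frac13}\big)^2F(V,t)\,dv\right);$$ that is, for every $T>0$, $t\mapsto F(\cdot,t)$ is a weak-$*$ continuous curve on $[0,T]$ of nonnegative Radon measures on $[0,\infty)$ (tested against $C_c([0,\infty))$), $F(\cdot,0)$ is a probability measure, and for all $\Psi\in C^1_c([0,T)\times[0,\infty))$ $$-\int_0^T\!\int_{[0,\infty)}\Big\{\partial_t\Psi(V,t)+\lambda\int_{[0,\infty)}\big(V^{\frac13}+v^{\frac13}\big)^2\big[\Psi(V+v,t)-\Psi(V,t)\big]G(dv)\Big\}F(dV,t)\,dt=\int_{[0,\infty)}\Psi(V,0)\,F(dV,0).$$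 Then $F(\cdot,t)$ is a probability measure for every $t\ge0$, and $$F(Wt^3,t)\,t^3\ \overset{*}{\rightharpoonup}\ \delta(W-a)\quad\text{as }t\to\infty\ \text{ in }\mathcal M([0,\infty)),\qquad a=\frac{\lambda^3}{27}\left(\int_{[0,\infty)}v\,G(dv)\right)^3.$$ Here $F(Wt^3,t)t^3$ denotes the image of $F(\cdot,t)$ under $V\mapsto W=V/t^3$, and the convergence means that $\int\varphi\big(V/t^3\big)F(dV,t)\to\varphi(a)$ for every continuous $\varphi:[0,\infty)\to\mathbb R$ vanishing at infinity. -/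

import Mathlib

open MeasureTheory Filter Topology Set
open scoped NNReal ZeroAtInfty

noncomputable section

/-- The constant `λ = U π (3 / (4 π)) ^ (2 / 3)` in the equation for the distribution of volumes;
`U` is the (rescaled) speed of the tagged particle. -/
def rateConst (U : ℝ) : ℝ :=
  U * Real.pi * (3 / (4 * Real.pi)) ^ (2 / 3 : ℝ)

/-- The adjoint collision operator acting on functions of the volume variable,
`C[ψ](V) = λ ∫ (V^{1/3} + v^{1/3})² (ψ(V + v) - ψ(V)) G(dv)`. -/
def adjointCollision (lam : ℝ) (G : Measure ℝ≥0) (ψ : ℝ → ℝ) (V : ℝ≥0) : ℝ :=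
  lam * ∫ v : ℝ≥0, ((V : ℝ) ^ (1 / 3 : ℝ) + (v : ℝ) ^ (1 / 3 : ℝ)) ^ 2 *
    (ψ ((V : ℝ) + (v : ℝ)) - ψ (V : ℝ)) ∂G

/-- `F` is a weak (measure valued) solution on `[0, T]` of
`∂ₜ F(V,t) = λ (∫_{[0,V]} G(dv) ((V-v)^{1/3} + v^{1/3})² F(V-v,t)
  - ∫_{[0,∞)} G(dv) (V^{1/3} + v^{1/3})² F(V,t))`:
a weak-* continuous curve of nonnegative Radon measures on `[0,∞)` starting from a probability
measure and satisfying the equation against all test functions in `C¹_c([0,T) × [0,∞))`.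
Such test functions are exactly the restrictions to `t ≥ 0`, `V ≥ 0` of compactly supported `C¹`
functions on the plane whose support lies in `{t < T}`. -/
structure IsWeakSolutionOn (lam : ℝ) (G : Measure ℝ≥0) (F : ℝ → Measure ℝ≥0) (T : ℝ) : Prop where
  radon : ∀ t ∈ Icc 0 T, IsFiniteMeasureOnCompacts (F t)
  continuousOn : ∀ φ : ℝ≥0 → ℝ, Continuous φ → HasCompactSupport φ →
    ContinuousOn (fun t => ∫ V, φ V ∂(F t)) (Icc 0 T)
  initial : IsProbabilityMeasure (F 0)
  weak : ∀ Ψ : ℝ × ℝ → ℝ, ContDiff ℝ 1 Ψ → HasCompactSupport Ψ →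
    tsupport Ψ ⊆ Iio T ×ˢ univ →
    -(∫ t in (0 : ℝ)..T, ∫ V : ℝ≥0,
        (deriv (fun s => Ψ (s, (V : ℝ))) t +
          adjointCollision lam G (fun W => Ψ (t, W)) V) ∂(F t))
      = ∫ V : ℝ≥0, Ψ (0, (V : ℝ)) ∂(F 0)

/-- A global weak solution: a weak solution on `[0, T]` for every `T > 0`. -/
def IsWeakSolution (lam : ℝ) (G : Measure ℝ≥0) (F : ℝ → Measure ℝ≥0) : Prop :=
  ∀ T : ℝ, 0 < T → IsWeakSolutionOn lam G F T

/-- The measure in the variable `W = V / t³` written `F(W t³, t) t³ dW` in terms of densities: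
the image of `F t` under `V ↦ V / t³`. -/
def rescaled (F : ℝ → Measure ℝ≥0) (t : ℝ) : Measure ℝ≥0 :=
  (F t).map (fun V => V / (Real.toNNReal t) ^ 3)

/-- Weak-* convergence in the space of measures on `[0,∞)`, regarded as the dual of the space of
continuous functions vanishing at infinity. -/
def TendstoWeakStar {ι : Type*} (μ : ι → Measure ℝ≥0) (l : Filter ι) (ν : Measure ℝ≥0) : Prop :=
  ∀ φ : C₀(ℝ≥0, ℝ), Tendsto (fun i => ∫ x, φ x ∂(μ i)) l (𝓝 (∫ x, φ x ∂ν))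

end

/-! Write X for `smoothCbrt V`, which behaves like V^{1/3}, m for the first moment of G, and c =
λm/3. A collision with v occurs at rate λ(V^{1/3} + v^{1/3})² G(dv) and raises X by about v / (3
V^{2/3}). Hence the mean drift of X tends to c as V → ∞, while individual increments of X become
small. So X should grow like ct with a law of large numbers, and V/t³ should concentrate at c³.

This is made rigorous with Laplace transforms at scale ε = k/T. Applied to exp(-εX), the adjoint
collision operator gives -εc exp(-εX) up to an error λε(`quadraticError` + `driftError`)
(`abs_adjointCollision_expCbrt_add_le`). The quadratic error vanishes with ε. The drift error is
small only for large V; elsewhere it is controlled by the dissipation of exp(-X), whose total over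
all times is at most 1 (`exists_driftError_le`, `integral_neg_adjointCollision_le`). Integrating
over [0,T] with the factor exp(εcs) yields ∫ exp(-kX/T) dF_T → exp(-kc)
(`tendsto_exp_mul_integral`).

The cases k = 1, 2 show that exp(-X/T) converges to exp(-c) in mean square, which gives the weak-*
limit. Conservation of mass comes from an approximation: compactly supported cutoffs, whose
collision terms are bounded uniformly in the cutoff, allow the constant function 1 as a test
function. -/

noncomputable section

/-! ### Smoothed cube root, its increments and its limiting drift -/

/-- A smooth proper function on the line which behaves like the cube root at infinity. -/
def smoothCbrt (V : ℝ) : ℝ := (√(1 + V ^ 2)) ^ (1 / 3 : ℝ)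

theorem smoothCbrt_pow_three (V : ℝ) : smoothCbrt V ^ 3 = √(1 + V ^ 2) := by
  rw [smoothCbrt, ← Real.rpow_natCast, ← Real.rpow_mul (Real.sqrt_nonneg _)]
  norm_num

theorem one_le_smoothCbrt (V : ℝ) : 1 ≤ smoothCbrt V := by
  apply Real.one_le_rpow _ (by norm_num)
  rw [Real.one_le_sqrt]
  nlinarith [sq_nonneg V]

theorem contDiff_smoothCbrt : ContDiff ℝ 1 smoothCbrt := by
  have h : ∀ V : ℝ, (1 + V ^ 2 : ℝ) ≠ 0 := fun V => by positivity
  refine ContDiff.rpow_const_of_ne (ContDiff.sqrt (by fun_prop) h) fun V => ?_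
  exact (Real.sqrt_pos.2 (by positivity)).ne'

theorem le_smoothCbrt_pow_three (V : ℝ) : V ≤ smoothCbrt V ^ 3 := by
  rw [smoothCbrt_pow_three]
  exact Real.le_sqrt_of_sq_le (by linarith)

theorem smoothCbrt_pow_three_le {V : ℝ} (hV : 0 ≤ V) : smoothCbrt V ^ 3 ≤ V + 1 := by
  rw [smoothCbrt_pow_three]
  exact Real.sqrt_le_iff.2 ⟨by linarith, by nlinarith⟩

theorem smoothCbrt_mono {V W : ℝ} (hV : 0 ≤ V) (h : V ≤ W) : smoothCbrt V ≤ smoothCbrt W := by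
  apply Real.rpow_le_rpow (Real.sqrt_nonneg _) _ (by norm_num)
  apply Real.sqrt_le_sqrt
  nlinarith

theorem smoothCbrt_strictMono {V W : ℝ} (hV : 0 ≤ V) (h : V < W) :
    smoothCbrt V < smoothCbrt W := by
  apply Real.rpow_lt_rpow (Real.sqrt_nonneg _) _ (by norm_num)
  apply Real.sqrt_lt_sqrt <;> nlinarith

theorem sqrt_one_add_sq_add_le (V : ℝ) {v : ℝ} (hv : 0 ≤ v) :
    √(1 + (V + v) ^ 2) ≤ √(1 + V ^ 2) + v := by
  refine Real.sqrt_le_iff.2 ⟨by positivity, ?_⟩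
  have h1 : V ≤ √(1 + V ^ 2) := Real.le_sqrt_of_sq_le (by linarith)
  have h2 := Real.sq_sqrt (show (0 : ℝ) ≤ 1 + V ^ 2 by positivity)
  nlinarith

theorem rpow_third_pow_three {V : ℝ} (hV : 0 ≤ V) : (V ^ (1 / 3 : ℝ)) ^ 3 = V := by
  rw [← Real.rpow_natCast, ← Real.rpow_mul hV]
  norm_num

theorem tendsto_sqrt_one_add_sq_sub :
    Tendsto (fun V : ℝ => √(1 + V ^ 2) - V) atTop (𝓝 0) := by
  have h : Tendsto (fun V : ℝ => V⁻¹) atTop (𝓝 0) := tendsto_inv_atTop_zero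
  refine tendsto_of_tendsto_of_tendsto_of_le_of_le' tendsto_const_nhds h ?_ ?_
  · exact Eventually.of_forall fun V => sub_nonneg.2 (Real.le_sqrt_of_sq_le (by linarith))
  · filter_upwards [eventually_gt_atTop 0] with V hV
    rw [sub_le_iff_le_add]
    refine Real.sqrt_le_iff.2 ⟨by positivity, ?_⟩
    have : V⁻¹ * V = 1 := inv_mul_cancel₀ hV.ne'
    nlinarith [sq_nonneg V⁻¹]

/-- The collision rate `(V^{1/3} + v^{1/3})²`. -/
def collisionRate (V v : ℝ≥0) : ℝ := ((V : ℝ) ^ (1 / 3 : ℝ) + (v : ℝ) ^ (1 / 3 : ℝ)) ^ 2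

/-- The increment of `smoothCbrt` in a collision. -/
def cbrtIncrement (V v : ℝ≥0) : ℝ := smoothCbrt ((V : ℝ) + v) - smoothCbrt V

theorem collisionRate_nonneg (V v : ℝ≥0) : 0 ≤ collisionRate V v := sq_nonneg _

theorem cbrtIncrement_nonneg (V v : ℝ≥0) : 0 ≤ cbrtIncrement V v :=
  sub_nonneg.2 (smoothCbrt_mono V.2 (by simp))

theorem cbrtIncrement_mul (V v : ℝ≥0) :
    cbrtIncrement V v * (smoothCbrt ((V : ℝ) + v) ^ 2
      + smoothCbrt ((V : ℝ) + v) * smoothCbrt V + smoothCbrt V ^ 2)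
      = √(1 + ((V : ℝ) + v) ^ 2) - √(1 + (V : ℝ) ^ 2) := by
  rw [← smoothCbrt_pow_three, ← smoothCbrt_pow_three, cbrtIncrement]
  ring

theorem cbrtIncrement_le (V v : ℝ≥0) : cbrtIncrement V v * smoothCbrt V ^ 2 ≤ v := by
  have h1 := cbrtIncrement_mul V v
  have h2 := sqrt_one_add_sq_add_le V v.2
  have h3 := cbrtIncrement_nonneg V v
  have h4 := one_le_smoothCbrt V
  have h5 := one_le_smoothCbrt ((V : ℝ) + v)
  have h6 : 0 ≤ cbrtIncrement V v * (smoothCbrt ((V : ℝ) + v) ^ 2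
      + smoothCbrt ((V : ℝ) + v) * smoothCbrt V) := by positivity
  simp only [NNReal.val_eq_coe] at h2
  linarith

theorem cbrtIncrement_le_self (V v : ℝ≥0) : cbrtIncrement V v ≤ v := by
  have h1 := cbrtIncrement_le V v
  have h2 := cbrtIncrement_nonneg V v
  have h3 : 1 ≤ smoothCbrt V ^ 2 := one_le_pow₀ (one_le_smoothCbrt V)
  nlinarith

theorem rpow_third_le_smoothCbrt {V W : ℝ} (hV : 0 ≤ V) (h : V ≤ W) :
    V ^ (1 / 3 : ℝ) ≤ smoothCbrt W :=
  Real.rpow_le_rpow hV (Real.le_sqrt_of_sq_le (by nlinarith)) (by norm_num)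

/-- The rate is at most 4X(V+v)², and the difference-of-cubes factorisation bounds X(V+v)² times the
increment by v. The unbounded rate is thus compensated uniformly in V. -/
theorem collisionRate_mul_cbrtIncrement_le (V v : ℝ≥0) :
    collisionRate V v * cbrtIncrement V v ≤ 4 * v := by
  have h1 := cbrtIncrement_mul V v
  have h2 := sqrt_one_add_sq_add_le V v.2
  have h3 := cbrtIncrement_nonneg V v
  have h4 := one_le_smoothCbrt V
  have h5 := one_le_smoothCbrt ((V : ℝ) + v)
  have hr : collisionRate V v ≤ 4 * smoothCbrt ((V : ℝ) + v) ^ 2 := by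
    have a1 : (V : ℝ) ^ (1 / 3 : ℝ) ≤ smoothCbrt ((V : ℝ) + v) :=
      rpow_third_le_smoothCbrt V.2 (by simp)
    have a2 : (v : ℝ) ^ (1 / 3 : ℝ) ≤ smoothCbrt ((V : ℝ) + v) :=
      rpow_third_le_smoothCbrt v.2 (by simp)
    have a3 : 0 ≤ (V : ℝ) ^ (1 / 3 : ℝ) := by positivity
    have a4 : 0 ≤ (v : ℝ) ^ (1 / 3 : ℝ) := by positivity
    rw [collisionRate]
    nlinarith
  have h6 : 0 ≤ cbrtIncrement V v * (smoothCbrt ((V : ℝ) + v) * smoothCbrt V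
    + smoothCbrt V ^ 2) := by positivity
  have h7 := mul_le_mul_of_nonneg_right hr h3
  simp only [NNReal.val_eq_coe] at h2
  nlinarith

theorem tendsto_smoothCbrt_atTop : Tendsto smoothCbrt atTop atTop := by
  have h : Tendsto (fun V : ℝ => √(1 + V ^ 2)) atTop atTop :=
    tendsto_atTop_mono (fun V => Real.le_sqrt_of_sq_le (by simp)) tendsto_id
  exact (tendsto_rpow_atTop (by norm_num)).comp h

theorem tendsto_cbrtIncrement (v : ℝ≥0) :
    Tendsto (fun V : ℝ≥0 => cbrtIncrement V v) atTop (𝓝 0) := by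
  have hx : Tendsto (fun V : ℝ≥0 => smoothCbrt V) atTop atTop :=
    tendsto_smoothCbrt_atTop.comp (NNReal.tendsto_coe_atTop.2 tendsto_id)
  have h : Tendsto (fun V : ℝ≥0 => (v : ℝ) * (smoothCbrt V)⁻¹) atTop (𝓝 0) := by
    simpa using (tendsto_inv_atTop_zero.comp hx).const_mul (v : ℝ)
  refine squeeze_zero (fun V => cbrtIncrement_nonneg V v) (fun V => ?_) h
  have h1 := cbrtIncrement_le V v
  have h2 := one_le_smoothCbrt V
  have h3 := cbrtIncrement_nonneg V v
  rw [← div_eq_mul_inv, le_div_iff₀ (by linarith)]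
  have := mul_nonneg (mul_nonneg h3 (by linarith : 0 ≤ smoothCbrt V)) (sub_nonneg.2 h2)
  nlinarith

/-- After division by X(V)², the rate tends to 1 and the denominator x² + xy + y² of the difference
of cubes tends to 3, while the numerator tends to v. -/
theorem tendsto_collisionRate_mul_cbrtIncrement (v : ℝ≥0) :
    Tendsto (fun V : ℝ≥0 => collisionRate V v * cbrtIncrement V v) atTop (𝓝 (v / 3)) := by
  have hc : Tendsto (fun V : ℝ≥0 => (V : ℝ)) atTop atTop := NNReal.tendsto_coe_atTop.2 tendsto_id
  have hx : Tendsto (fun V : ℝ≥0 => smoothCbrt V) atTop atTop := tendsto_smoothCbrt_atTop.comp hc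
  have hxi : Tendsto (fun V : ℝ≥0 => (smoothCbrt V)⁻¹) atTop (𝓝 0) :=
    tendsto_inv_atTop_zero.comp hx
  have hz : Tendsto (fun V : ℝ≥0 => smoothCbrt ((V : ℝ) + v) / smoothCbrt V) atTop (𝓝 1) := by
    have := (((tendsto_cbrtIncrement v).mul hxi).const_add 1)
    simp only [mul_zero, add_zero] at this
    refine this.congr fun V => ?_
    have h2 := one_le_smoothCbrt V
    rw [cbrtIncrement]
    field_simp
    ring
  have he := tendsto_sqrt_one_add_sq_sub.comp hc
  have hw : Tendsto (fun V : ℝ≥0 => √(1 + ((V : ℝ) + v) ^ 2) - √(1 + (V : ℝ) ^ 2)) atTop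
      (𝓝 v) := by
    have h1 : Tendsto (fun V : ℝ≥0 => (V : ℝ) + v) atTop atTop :=
      tendsto_atTop_add_const_right _ _ hc
    have := ((tendsto_sqrt_one_add_sq_sub.comp h1).sub he).add_const (v : ℝ)
    simp only [sub_zero, zero_add] at this
    refine this.congr fun V => ?_
    simp only [Function.comp]
    ring
  have hy : Tendsto (fun V : ℝ≥0 => (V : ℝ) ^ (1 / 3 : ℝ) / smoothCbrt V) atTop (𝓝 1) := by
    have h0 : Tendsto (fun V : ℝ≥0 => 1 - (smoothCbrt V)⁻¹) atTop (𝓝 1) := by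
      simpa using hxi.const_sub 1
    refine tendsto_of_tendsto_of_tendsto_of_le_of_le h0 tendsto_const_nhds (fun V => ?_)
      (fun V => ?_)
    · have h2 := one_le_smoothCbrt V
      have h3 := smoothCbrt_pow_three_le V.2
      have h4 := rpow_third_pow_three V.2
      have h5 : (0 : ℝ) ≤ (V : ℝ) ^ (1 / 3 : ℝ) := by positivity
      have h6 : (V : ℝ) ^ (1 / 3 : ℝ) ≤ smoothCbrt V := rpow_third_le_smoothCbrt V.2 le_rfl
      simp only [NNReal.val_eq_coe] at h3 h4
      -- The cubes differ by at most 1 and x² + xy + y² ≥ 1, since x ≥ 1.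
      have h7 : smoothCbrt V - (V : ℝ) ^ (1 / 3 : ℝ) ≤ 1 := by
        generalize smoothCbrt V = x at *
        generalize (V : ℝ) ^ (1 / 3 : ℝ) = y at *
        have a1 : (x - y) * (x ^ 2 + x * y + y ^ 2) ≤ 1 := by nlinarith
        have a2 : 1 ≤ x ^ 2 + x * y + y ^ 2 := by nlinarith [mul_nonneg (by linarith : 0 ≤ x) h5]
        nlinarith
      rw [le_div_iff₀ (by linarith), sub_mul, inv_mul_cancel₀ (by linarith)]
      linarith
    · exact div_le_one_of_le₀ (rpow_third_le_smoothCbrt V.2 le_rfl)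
        (by linarith [one_le_smoothCbrt V])
  have hv : Tendsto (fun V : ℝ≥0 => (v : ℝ) ^ (1 / 3 : ℝ) / smoothCbrt V) atTop (𝓝 0) := by
    simpa [div_eq_mul_inv] using hxi.const_mul ((v : ℝ) ^ (1 / 3 : ℝ))
  have key := (((hy.add hv).pow 2).mul hw).div (((hz.pow 2).add hz).add_const 1) (by norm_num)
  have e : ((1 : ℝ) + 0) ^ 2 * v / (1 ^ 2 + 1 + 1) = v / 3 := by norm_num
  rw [e] at key
  refine key.congr fun V => ?_
  simp only [Pi.div_apply]
  rw [← cbrtIncrement_mul, collisionRate]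
  have h1 := one_le_smoothCbrt V
  have h2 := one_le_smoothCbrt ((V : ℝ) + v)
  have h3 : 0 < smoothCbrt ((V : ℝ) + v) ^ 2
      + smoothCbrt ((V : ℝ) + v) * smoothCbrt V + smoothCbrt V ^ 2 := by positivity
  field_simp

/-! ### The adjoint collision operator on functions Lipschitz in the cube root -/

/-- Increments of `ψ` in collisions are at most `L` times those of `smoothCbrt`. -/
def CollisionLipschitz (L : ℝ) (ψ : ℝ → ℝ) : Prop :=
  ∀ V v : ℝ≥0, |ψ ((V : ℝ) + v) - ψ V| ≤ L * cbrtIncrement V v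

theorem adjointCollision_eq (lam : ℝ) (G : Measure ℝ≥0) (ψ : ℝ → ℝ) (V : ℝ≥0) :
    adjointCollision lam G ψ V
      = lam * ∫ v : ℝ≥0, collisionRate V v * (ψ ((V : ℝ) + v) - ψ V) ∂G := rfl

@[fun_prop]
theorem continuous_collisionRate : Continuous fun p : ℝ≥0 × ℝ≥0 => collisionRate p.1 p.2 := by
  unfold collisionRate
  have h : ∀ x : ℝ, x ≠ 0 ∨ 0 ≤ (1 / 3 : ℝ) := fun x => Or.inr (by norm_num)
  have h1 : Continuous fun p : ℝ≥0 × ℝ≥0 => (p.1 : ℝ) ^ (1 / 3 : ℝ) :=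
    Continuous.rpow_const (by fun_prop) fun _ => h _
  have h2 : Continuous fun p : ℝ≥0 × ℝ≥0 => (p.2 : ℝ) ^ (1 / 3 : ℝ) :=
    Continuous.rpow_const (by fun_prop) fun _ => h _
  exact (h1.add h2).pow 2

theorem continuous_collisionRate_mul {ψ : ℝ → ℝ} (hψ : Continuous ψ) :
    Continuous fun p : ℝ≥0 × ℝ≥0 =>
      collisionRate p.1 p.2 * (ψ ((p.1 : ℝ) + p.2) - ψ p.1) :=
  continuous_collisionRate.mul (by fun_prop)

/-- This bound does not depend on V, so it serves as the dominating function, integrable once G has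
a first moment, for the boundedness, continuity and limits of the operator. -/
theorem CollisionLipschitz.abs_collisionRate_mul_le {L : ℝ} (hL : 0 ≤ L) {ψ : ℝ → ℝ}
    (h : CollisionLipschitz L ψ) (V v : ℝ≥0) :
    |collisionRate V v * (ψ ((V : ℝ) + v) - ψ V)| ≤ 4 * L * v := by
  rw [abs_mul, abs_of_nonneg (collisionRate_nonneg V v)]
  have h1 := mul_le_mul_of_nonneg_left (h V v) (collisionRate_nonneg V v)
  have h2 := mul_le_mul_of_nonneg_left (collisionRate_mul_cbrtIncrement_le V v) hL
  linarith

section Operator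

variable {G : Measure ℝ≥0} {lam L : ℝ} {ψ : ℝ → ℝ}

theorem CollisionLipschitz.integrable (hG : Integrable (fun v : ℝ≥0 => (v : ℝ)) G)
    (hL : 0 ≤ L) (h : CollisionLipschitz L ψ) (hψ : Continuous ψ) (V : ℝ≥0) :
    Integrable (fun v : ℝ≥0 => collisionRate V v * (ψ ((V : ℝ) + v) - ψ V)) G := by
  refine (hG.const_mul (4 * L)).mono' ?_ (Eventually.of_forall (h.abs_collisionRate_mul_le hL V))
  exact ((continuous_collisionRate_mul hψ).comp (by fun_prop :
    Continuous fun v : ℝ≥0 => (V, v))).aestronglyMeasurable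

theorem CollisionLipschitz.abs_adjointCollision_le
    (hG : Integrable (fun v : ℝ≥0 => (v : ℝ)) G) (hlam : 0 ≤ lam)
    (hL : 0 ≤ L) (h : CollisionLipschitz L ψ) (V : ℝ≥0) :
    |adjointCollision lam G ψ V| ≤ lam * (4 * L * ∫ v : ℝ≥0, (v : ℝ) ∂G) := by
  rw [adjointCollision_eq, abs_mul, abs_of_nonneg hlam]
  refine mul_le_mul_of_nonneg_left ?_ hlam
  rw [← integral_const_mul]
  exact norm_integral_le_of_norm_le (f := fun v : ℝ≥0 => collisionRate V v * (ψ ((V : ℝ) + v) - ψ V)) (hG.const_mul (4 * L))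
    (Eventually.of_forall (h.abs_collisionRate_mul_le hL V))

theorem CollisionLipschitz.continuous_adjointCollision
    (hG : Integrable (fun v : ℝ≥0 => (v : ℝ)) G)
    (hL : 0 ≤ L) (h : CollisionLipschitz L ψ) (hψ : Continuous ψ) :
    Continuous (adjointCollision lam G ψ) := by
  refine continuous_const.mul (continuous_of_dominated (bound := fun v => 4 * L * v)
    (fun V => ?_) (fun V => Eventually.of_forall (h.abs_collisionRate_mul_le hL V))
    (hG.const_mul (4 * L)) (Eventually.of_forall fun v => ?_))
  · exact (h.integrable hG hL hψ V).aestronglyMeasurable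
  · exact (continuous_collisionRate_mul hψ).comp (by fun_prop :
      Continuous fun V : ℝ≥0 => (V, v))

theorem tendsto_adjointCollision {f : ℕ → ℝ → ℝ}
    (hG : Integrable (fun v : ℝ≥0 => (v : ℝ)) G) (hL : 0 ≤ L)
    (h : ∀ n, CollisionLipschitz L (f n)) (hf : ∀ n, Continuous (f n))
    (hlim : ∀ V : ℝ≥0, Tendsto (fun n => f n V) atTop (𝓝 (ψ V))) (V : ℝ≥0) :
    Tendsto (fun n => adjointCollision lam G (f n) V) atTop
      (𝓝 (adjointCollision lam G ψ V)) := by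
  refine Tendsto.const_mul lam (tendsto_integral_of_dominated_convergence (fun v => 4 * L * v)
    (fun n => ((h n).integrable hG hL (hf n) V).aestronglyMeasurable) (hG.const_mul (4 * L))
    (fun n => Eventually.of_forall ((h n).abs_collisionRate_mul_le hL V))
    (Eventually.of_forall fun v => ?_))
  have := hlim (V + v)
  rw [NNReal.coe_add] at this
  exact (this.sub (hlim V)).const_mul _

theorem adjointCollision_nonpos (hlam : 0 ≤ lam)
    (hψ : ∀ V v : ℝ≥0, ψ ((V : ℝ) + v) ≤ ψ V) (V : ℝ≥0) :
    adjointCollision lam G ψ V ≤ 0 := by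
  refine mul_nonpos_of_nonneg_of_nonpos hlam (integral_nonpos fun v => ?_)
  exact mul_nonpos_of_nonneg_of_nonpos (collisionRate_nonneg V v) (sub_nonpos.2 (hψ V v))

theorem adjointCollision_const_mul (a : ℝ) (V : ℝ≥0) :
    adjointCollision lam G (fun W => a * ψ W) V = a * adjointCollision lam G ψ V := by
  rw [adjointCollision_eq, adjointCollision_eq, mul_left_comm, ← integral_const_mul a]
  refine congrArg (lam * ·) (integral_congr_ae (Eventually.of_forall fun v => ?_))
  simp only
  ring

theorem exists_bound_of_hasCompactSupport (h : HasCompactSupport ψ) :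
    ∃ M : ℝ≥0, ∀ V : ℝ, (M : ℝ) ≤ V → ψ V = 0 := by
  obtain ⟨M, hM⟩ := h.isCompact.bddAbove
  refine ⟨(M + 1).toNNReal, fun V hV => ?_⟩
  by_contra hne
  have h1 := hM (subset_tsupport ψ hne)
  have h2 := Real.le_coe_toNNReal (M + 1)
  linarith

theorem hasCompactSupport_nnreal_of_bound {g : ℝ≥0 → ℝ} (M : ℝ≥0)
    (h : ∀ V, M ≤ V → g V = 0) : HasCompactSupport g := by
  refine HasCompactSupport.intro (isCompact_Icc (a := 0) (b := M)) fun V hV => h V ?_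
  by_contra hlt
  exact hV ⟨zero_le, (not_le.1 hlt).le⟩

/-- Collisions only increase the volume, so from beyond the support of ψ it is never re-entered. -/
theorem hasCompactSupport_adjointCollision (h : HasCompactSupport ψ) :
    HasCompactSupport (adjointCollision lam G ψ) := by
  obtain ⟨M, hM⟩ := exists_bound_of_hasCompactSupport h
  refine hasCompactSupport_nnreal_of_bound M fun V hV => ?_
  have hV' : (M : ℝ) ≤ V := hV
  have : ∀ v : ℝ≥0, ψ ((V : ℝ) + v) - ψ V = 0 := fun v => by
    rw [hM _ hV', hM _ (hV'.trans (by simp)), sub_zero]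
  simp [adjointCollision_eq, this]

theorem hasCompactSupport_comp_coe (h : HasCompactSupport ψ) :
    HasCompactSupport fun V : ℝ≥0 => ψ V := by
  obtain ⟨M, hM⟩ := exists_bound_of_hasCompactSupport h
  exact hasCompactSupport_nnreal_of_bound M fun V hV => hM V hV

end Operator

/-! ### From the weak formulation to an integral equation in time -/

/-- Du Bois-Reymond argument. With N the claimed right-hand side, the hypothesis and integration by
parts for N together give ∫ χ'(m - N) = 0; choosing χ' as m - N times a nonnegative weight forces m
= N. -/
theorem eq_integral_of_forall_test {T : ℝ} (hT : 0 < T) {m n : ℝ → ℝ}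
    (hm : ContinuousOn m (Icc 0 T)) (hn : ContinuousOn n (Icc 0 T))
    (h : ∀ χ : ℝ → ℝ, ContDiff ℝ 1 χ → HasCompactSupport χ → tsupport χ ⊆ Iio T →
      -(∫ t in (0 : ℝ)..T, (deriv χ t * m t + χ t * n t)) = χ 0 * m 0) :
    ∀ t ∈ Ico 0 T, m t = m 0 + ∫ s in (0 : ℝ)..t, n s := by
  intro t₀ ht₀
  obtain ⟨T', hT1, hT2⟩ := exists_between ht₀.2
  set m' : ℝ → ℝ := IccExtend hT.le ((Icc 0 T).domRestrict m) with hm'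
  set n' : ℝ → ℝ := IccExtend hT.le ((Icc 0 T).domRestrict n) with hn'
  have cm : Continuous m' := (continuousOn_iff_continuous_domRestrict.1 hm).Icc_extend'
  have cn : Continuous n' := (continuousOn_iff_continuous_domRestrict.1 hn).Icc_extend'
  have em : ∀ t ∈ Icc 0 T, m' t = m t := fun t ht => IccExtend_of_mem _ _ ht
  have en : ∀ t ∈ Icc 0 T, n' t = n t := fun t ht => IccExtend_of_mem _ _ ht
  set N : ℝ → ℝ := fun t => m 0 + ∫ s in (0 : ℝ)..t, n' s with hN
  have dN : ∀ t, HasDerivAt N (n' t) t := fun t =>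
    (intervalIntegral.integral_hasDerivAt_right (cn.intervalIntegrable _ _)
      (cn.stronglyMeasurableAtFilter _ _) cn.continuousAt).const_add _
  have cN : Continuous N := continuous_iff_continuousAt.2 fun t => (dN t).continuousAt
  -- The weight is positive at t₀ and vanishes from T' < T on, so the primitive based at T' is zero
  -- there and its closed support stays strictly below T.
  set p : ℝ → ℝ := fun t => (m' t - N t) * max 0 (T' - t) with hp
  have cp : Continuous p := by fun_prop
  set χ₀ : ℝ → ℝ := fun t => ∫ s in T'..t, p s with hχ₀
  have dχ₀ : ∀ t, HasDerivAt χ₀ (p t) t := fun t =>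
    intervalIntegral.integral_hasDerivAt_right (cp.intervalIntegrable _ _)
      (cp.stronglyMeasurableAtFilter _ _) cp.continuousAt
  have cχ₀ : Continuous χ₀ := continuous_iff_continuousAt.2 fun t => (dχ₀ t).continuousAt
  have zχ₀ : ∀ t, T' ≤ t → χ₀ t = 0 := fun t ht => by
    refine (intervalIntegral.integral_congr fun s hs => ?_).trans intervalIntegral.integral_zero
    rw [uIcc_of_le ht] at hs
    simp only [hp]
    rw [max_eq_left (by linarith [hs.1]), mul_zero]
  have sχ₀ : ContDiff ℝ 1 χ₀ := by
    refine contDiff_one_iff_deriv.2 ⟨fun t => (dχ₀ t).differentiableAt, ?_⟩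
    rwa [show deriv χ₀ = p from funext fun t => (dχ₀ t).deriv]
  -- The cutoff equals 1 for t ≥ -1 and 0 for t ≤ -2: it gives compact support without affecting
  -- [0,T].
  set χ : ℝ → ℝ := fun t => Real.smoothTransition (t + 2) * χ₀ t with hχ
  have eχ : ∀ t, -1 ≤ t → χ t = χ₀ t := fun t ht => by
    simp only [hχ]
    rw [Real.smoothTransition.one_of_one_le (by linarith), one_mul]
  have dχ : ∀ t, 0 ≤ t → deriv χ t = p t := fun t ht => by
    rw [← (dχ₀ t).deriv]
    refine Filter.EventuallyEq.deriv_eq ?_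
    filter_upwards [eventually_gt_nhds (show (-1 : ℝ) < t by linarith)] with s hs
    exact eχ s hs.le
  have supp : tsupport χ ⊆ Icc (-2) T' := by
    refine closure_minimal (fun t ht => ?_) isClosed_Icc
    by_contra hc
    rw [mem_Icc, not_and_or, not_le, not_le] at hc
    apply ht
    simp only [hχ]
    rcases hc with hc | hc
    · rw [Real.smoothTransition.zero_of_nonpos (by linarith), zero_mul]
    · rw [zχ₀ t hc.le, mul_zero]
  have key := h χ ((Real.smoothTransition.contDiff.comp (by fun_prop)).mul sχ₀)
    (isCompact_Icc.of_isClosed_subset (isClosed_tsupport _) supp)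
    (supp.trans fun t ht => lt_of_le_of_lt ht.2 hT2)
  have I1 : ∫ t in (0 : ℝ)..T, (deriv χ t * m t + χ t * n t)
      = ∫ t in (0 : ℝ)..T, (p t * m' t + χ₀ t * n' t) := by
    refine intervalIntegral.integral_congr fun t ht => ?_
    rw [uIcc_of_le hT.le] at ht
    rw [dχ t ht.1, eχ t (by linarith [ht.1]), em t ht, en t ht]
  have I2 : ∫ t in (0 : ℝ)..T, (p t * N t + χ₀ t * n' t) = χ₀ T * N T - χ₀ 0 * N 0 :=
    intervalIntegral.integral_eq_sub_of_hasDerivAt (fun t _ => (dχ₀ t).mul (dN t))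
      (Continuous.intervalIntegrable (by fun_prop) _ _)
  have N0 : N 0 = m 0 := by simp [hN]
  rw [I1, eχ 0 (by norm_num)] at key
  rw [zχ₀ T hT2.le, N0] at I2
  have I3 : ∫ t in (0 : ℝ)..T, (m' t - N t) ^ 2 * max 0 (T' - t) = 0 := by
    have := intervalIntegral.integral_sub (μ := volume) (a := 0) (b := T)
      (f := fun t => p t * m' t + χ₀ t * n' t) (g := fun t => p t * N t + χ₀ t * n' t)
      (Continuous.intervalIntegrable (by fun_prop) _ _)
      (Continuous.intervalIntegrable (by fun_prop) _ _)
    rw [I2] at this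
    refine Eq.trans (intervalIntegral.integral_congr fun t _ => ?_)
      (this.trans (by linarith))
    simp only [hp]
    ring
  have hz : m' t₀ = N t₀ := by
    by_contra hne
    refine (intervalIntegral.integral_pos hT (f := fun t => (m' t - N t) ^ 2 * max 0 (T' - t))
      (by fun_prop) (fun t _ => by positivity) ⟨t₀, ⟨ht₀.1, ht₀.2.le⟩, ?_⟩).ne' I3
    have h1 : 0 < (m' t₀ - N t₀) ^ 2 := by
      have := sub_ne_zero.2 hne
      positivity
    have h2 : 0 < max 0 (T' - t₀) := lt_max_of_lt_right (by linarith)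
    positivity
  rw [← em t₀ ⟨ht₀.1, ht₀.2.le⟩, hz]
  simp only [hN]
  congr 1
  refine intervalIntegral.integral_congr fun t ht => ?_
  rw [uIcc_of_le ht₀.1] at ht
  exact en t ⟨ht.1, ht.2.trans ht₀.2.le⟩

section WeakSolution

variable {G : Measure ℝ≥0} {lam L T : ℝ} {ψ : ℝ → ℝ} {F : ℝ → Measure ℝ≥0}

theorem integrable_of_hasCompactSupport_nnreal {μ : Measure ℝ≥0}
    (hμ : IsFiniteMeasureOnCompacts μ) {g : ℝ≥0 → ℝ} (hg : Continuous g)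
    (hs : HasCompactSupport g) : Integrable g μ :=
  hg.integrable_of_hasCompactSupport hs

theorem IsWeakSolutionOn.integral_eq (hF : IsWeakSolutionOn lam G F T) (hT : 0 < T)
    (hG : Integrable (fun v : ℝ≥0 => (v : ℝ)) G) (hL : 0 ≤ L)
    (hψ : ContDiff ℝ 1 ψ) (hs : HasCompactSupport ψ) (hlip : CollisionLipschitz L ψ) :
    ∀ t ∈ Ico 0 T, ∫ V : ℝ≥0, ψ V ∂(F t) = ∫ V : ℝ≥0, ψ V ∂(F 0)
      + ∫ s in (0 : ℝ)..t, ∫ V, adjointCollision lam G ψ V ∂(F s) := by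
  have cA : Continuous (adjointCollision lam G ψ) :=
    hlip.continuous_adjointCollision hG hL hψ.continuous
  have sA := hasCompactSupport_adjointCollision (lam := lam) (G := G) hs
  have cψ : Continuous fun V : ℝ≥0 => ψ V := hψ.continuous.comp (by fun_prop)
  have sψ := hasCompactSupport_comp_coe hs
  refine eq_integral_of_forall_test hT (hF.continuousOn _ cψ sψ) (hF.continuousOn _ cA sA)
    fun χ hχ hχs hχT => ?_
  have hsupp : tsupport (fun p : ℝ × ℝ => χ p.1 * ψ p.2) ⊆ tsupport χ ×ˢ tsupport ψ := by
    refine closure_minimal (fun p hp => ?_)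
      ((isClosed_tsupport _).prod (isClosed_tsupport _))
    rw [Function.mem_support, mul_ne_zero_iff] at hp
    exact ⟨subset_tsupport _ hp.1, subset_tsupport _ hp.2⟩
  have key := hF.weak (fun p => χ p.1 * ψ p.2)
    ((hχ.comp contDiff_fst).mul (hψ.comp contDiff_snd))
    ((hχs.isCompact.prod hs.isCompact).of_isClosed_subset (isClosed_tsupport _) hsupp)
    (hsupp.trans (prod_mono hχT (subset_univ _)))
  simp only [integral_const_mul] at key
  rw [← key, neg_inj]
  refine intervalIntegral.integral_congr fun t ht => ?_
  rw [uIcc_of_le hT.le] at ht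
  have hfin := hF.radon t ht
  simp only [adjointCollision_const_mul]
  rw [integral_add, integral_const_mul]
  · congr 1
    rw [← integral_const_mul]
    congr 1
    ext V
    rw [deriv_mul_const (hχ.differentiable (by norm_num) t)]
  · refine Integrable.congr ((integrable_of_hasCompactSupport_nnreal hfin cψ sψ).const_mul
      (deriv χ t)) (Eventually.of_forall fun V => ?_)
    simp only
    rw [deriv_mul_const (hχ.differentiable (by norm_num) t)]
  · exact (integrable_of_hasCompactSupport_nnreal hfin cA sA).const_mul _

/-- The exponential is an integrating factor: b = 0 serves for mass and dissipation, b = εc cancels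
the leading drift of exp(-εX). -/
theorem IsWeakSolution.exp_mul_integral_sub (hF : IsWeakSolution lam G F) (hT : 0 ≤ T)
    (hG : Integrable (fun v : ℝ≥0 => (v : ℝ)) G) (hL : 0 ≤ L)
    (hψ : ContDiff ℝ 1 ψ) (hs : HasCompactSupport ψ) (hlip : CollisionLipschitz L ψ) (b : ℝ) :
    Real.exp (b * T) * ∫ V : ℝ≥0, ψ V ∂(F T) - ∫ V : ℝ≥0, ψ V ∂(F 0)
      = ∫ s in (0 : ℝ)..T, Real.exp (b * s) * ((∫ V, adjointCollision lam G ψ V ∂(F s))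
        + b * ∫ V : ℝ≥0, ψ V ∂(F s)) := by
  -- The integral equation holds on a half-open interval, so a longer horizon is taken to include
  -- the endpoint T.
  have hF1 := hF (T + 1) (by linarith)
  have cA : Continuous (adjointCollision lam G ψ) :=
    hlip.continuous_adjointCollision hG hL hψ.continuous
  have sA := hasCompactSupport_adjointCollision (lam := lam) (G := G) hs
  have cψ : Continuous fun V : ℝ≥0 => ψ V := hψ.continuous.comp (by fun_prop)
  have sψ := hasCompactSupport_comp_coe hs
  have hsub : Icc 0 T ⊆ Icc 0 (T + 1) := Icc_subset_Icc_right (by linarith)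
  have cm := (hF1.continuousOn _ cψ sψ).mono hsub
  have cn := (hF1.continuousOn _ cA sA).mono hsub
  have ce : ContinuousOn (fun s : ℝ => Real.exp (b * s)) (Icc 0 T) := by fun_prop
  have heq := hF1.integral_eq (by linarith) hG hL hψ hs hlip
  symm
  have := intervalIntegral.integral_eq_sub_of_hasDerivAt_of_le hT (ce.mul cm)
    (f' := fun s => Real.exp (b * s) * ((∫ V, adjointCollision lam G ψ V ∂(F s))
        + b * ∫ V : ℝ≥0, ψ V ∂(F s))) (fun t ht => ?_) ?_
  · rw [this]
    simp
  · have h1 : HasDerivAt (fun t => ∫ V : ℝ≥0, ψ V ∂(F t))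
        (∫ V, adjointCollision lam G ψ V ∂(F t)) t := by
      have h2 : HasDerivAt (fun t => ∫ V : ℝ≥0, ψ V ∂(F 0)
          + ∫ s in (0 : ℝ)..t, ∫ V, adjointCollision lam G ψ V ∂(F s))
          (∫ V, adjointCollision lam G ψ V ∂(F t)) t := by
        refine HasDerivAt.const_add _ (intervalIntegral.integral_hasDerivAt_right ?_ ?_ ?_)
        · refine ContinuousOn.intervalIntegrable ?_
          rw [uIcc_of_le ht.1.le]
          exact cn.mono (Icc_subset_Icc_right ht.2.le)
        · exact (cn.mono Ioo_subset_Icc_self).stronglyMeasurableAtFilter isOpen_Ioo t ht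
        · exact cn.continuousAt (Icc_mem_nhds ht.1 ht.2)
      refine h2.congr_of_eventuallyEq ?_
      filter_upwards [Ioo_mem_nhds ht.1 ht.2] with s hs
      exact heq s ⟨hs.1.le, by linarith [hs.2]⟩
    have h3 : HasDerivAt (fun s : ℝ => Real.exp (b * s)) (Real.exp (b * t) * b) t := by
      simpa using ((hasDerivAt_id t).const_mul b).exp
    refine (h3.mul h1).congr_deriv ?_
    ring
  · refine ContinuousOn.intervalIntegrable ?_
    rw [uIcc_of_le hT]
    exact ce.mul (cn.add (continuousOn_const.mul cm))

end WeakSolution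

/-! ### Exponential test functions and their cutoffs -/

theorem contDiff_max_zero_sq : ContDiff ℝ 1 fun u : ℝ => max 0 u ^ 2 := by
  have hd : ∀ u : ℝ, HasDerivAt (fun u : ℝ => max 0 u ^ 2) (2 * max 0 u) u := by
    intro u
    rcases lt_trichotomy u 0 with hu | hu | hu
    · rw [max_eq_left hu.le, mul_zero]
      refine (hasDerivAt_const u (0 : ℝ)).congr_of_eventuallyEq ?_
      filter_upwards [eventually_lt_nhds hu] with x hx
      simp [max_eq_left hx.le]
    · subst hu
      rw [max_self, mul_zero, hasDerivAt_iff_isLittleO_nhds_zero]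
      have h1 : (fun h : ℝ => h ^ 2) =o[𝓝 0] fun h : ℝ => h := by
        simpa using Asymptotics.isLittleO_pow_pow (𝕜 := ℝ) (m := 1) (n := 2) (by norm_num)
      refine (Asymptotics.IsBigO.of_bound 1 (Eventually.of_forall fun h => ?_)).trans_isLittleO h1
      have h2 : |max 0 h| ≤ |h| := by
        rw [abs_of_nonneg (le_max_left _ _)]
        exact max_le (abs_nonneg _) (le_abs_self _)
      simpa using sq_le_sq.2 h2
    · rw [max_eq_right hu.le]
      have h1 : HasDerivAt (fun u : ℝ => u ^ 2) (2 * u) u := by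
        simpa using hasDerivAt_pow 2 u
      refine h1.congr_of_eventuallyEq ?_
      filter_upwards [eventually_gt_nhds hu] with x hx
      simp [max_eq_right hx.le]
  refine contDiff_one_iff_deriv.2 ⟨fun u => (hd u).differentiableAt, ?_⟩
  rw [show deriv (fun u : ℝ => max 0 u ^ 2) = fun u => 2 * max 0 u from
    funext fun u => (hd u).deriv]
  fun_prop

/-- The function `exp (-k V^{1/3})`, with the cube root smoothed. -/
def expCbrt (k : ℝ) (V : ℝ) : ℝ := Real.exp (-(k * smoothCbrt V))

/-- Compactly supported approximations of `expCbrt k`. -/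
def expCbrtCutoff (k : ℝ) (n : ℕ) (V : ℝ) : ℝ :=
  expCbrt k V * max 0 (1 - smoothCbrt V / (n + 1)) ^ 2

section Exp

variable {k : ℝ}

theorem continuous_expCbrt (k : ℝ) : Continuous (expCbrt k) :=
  Real.continuous_exp.comp (continuous_const.mul contDiff_smoothCbrt.continuous).neg

theorem expCbrt_pos (k V : ℝ) : 0 < expCbrt k V := Real.exp_pos _

theorem expCbrt_le_one (hk : 0 ≤ k) (V : ℝ) : expCbrt k V ≤ 1 := by
  rw [expCbrt, Real.exp_le_one_iff]
  have := one_le_smoothCbrt V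
  nlinarith

theorem expCbrt_add (k : ℝ) (V v : ℝ≥0) :
    expCbrt k ((V : ℝ) + v) = expCbrt k V * Real.exp (-(k * cbrtIncrement V v)) := by
  rw [expCbrt, expCbrt, ← Real.exp_add, cbrtIncrement]
  congr 1
  ring

theorem expCbrt_sub_le (hk : 0 ≤ k) (V v : ℝ≥0) :
    expCbrt k V - expCbrt k ((V : ℝ) + v) ≤ k * cbrtIncrement V v := by
  rw [expCbrt_add]
  have h1 := Real.add_one_le_exp (-(k * cbrtIncrement V v))
  have h2 := expCbrt_le_one hk V
  have h3 := expCbrt_pos k V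
  have h4 := mul_nonneg hk (cbrtIncrement_nonneg V v)
  nlinarith

theorem expCbrt_antitone (hk : 0 ≤ k) (V v : ℝ≥0) : expCbrt k ((V : ℝ) + v) ≤ expCbrt k V := by
  rw [expCbrt_add]
  refine mul_le_of_le_one_right (expCbrt_pos k V).le (Real.exp_le_one_iff.2 ?_)
  exact neg_nonpos.2 (mul_nonneg hk (cbrtIncrement_nonneg V v))

theorem collisionLipschitz_expCbrt (hk : 0 ≤ k) : CollisionLipschitz k (expCbrt k) := by
  intro V v
  rw [abs_sub_comm, abs_of_nonneg (sub_nonneg.2 (expCbrt_antitone hk V v))]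
  exact expCbrt_sub_le hk V v

theorem max_cutoff_mem (n : ℕ) (V : ℝ) :
    max 0 (1 - smoothCbrt V / (n + 1)) ∈ Icc (0 : ℝ) 1 := by
  have := one_le_smoothCbrt V
  refine ⟨le_max_left _ _, max_le zero_le_one ?_⟩
  have : 0 ≤ smoothCbrt V / (n + 1) := by positivity
  linarith

theorem expCbrtCutoff_nonneg (k : ℝ) (n : ℕ) (V : ℝ) : 0 ≤ expCbrtCutoff k n V :=
  mul_nonneg (expCbrt_pos k V).le (sq_nonneg _)

theorem expCbrtCutoff_le_one (hk : 0 ≤ k) (n : ℕ) (V : ℝ) : expCbrtCutoff k n V ≤ 1 := by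
  have h := max_cutoff_mem n V
  exact mul_le_one₀ (expCbrt_le_one hk V) (sq_nonneg _) (pow_le_one₀ h.1 h.2)

/-- Squaring the positive part removes its corner, which makes the cutoff an admissible C¹ test
function. -/
theorem contDiff_expCbrtCutoff (k : ℝ) (n : ℕ) : ContDiff ℝ 1 (expCbrtCutoff k n) := by
  have h := contDiff_smoothCbrt
  refine ContDiff.mul (Real.contDiff_exp.comp (contDiff_const.mul h).neg)
    (contDiff_max_zero_sq.comp (contDiff_const.sub (h.div_const _)))

theorem hasCompactSupport_expCbrtCutoff (k : ℝ) (n : ℕ) :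
    HasCompactSupport (expCbrtCutoff k n) := by
  refine HasCompactSupport.intro (isCompact_Icc (a := -((n : ℝ) + 1) ^ 3)
    (b := ((n : ℝ) + 1) ^ 3)) fun V hV => ?_
  have h1 : ((n : ℝ) + 1) ^ 3 ≤ smoothCbrt V ^ 3 := by
    rw [smoothCbrt_pow_three]
    refine le_trans ?_ (Real.abs_le_sqrt (show V ^ 2 ≤ 1 + V ^ 2 by linarith))
    by_contra hlt
    exact hV (abs_le.1 (not_le.1 hlt).le)
  have h2 : (n : ℝ) + 1 ≤ smoothCbrt V :=
    le_of_pow_le_pow_left₀ (by norm_num) (by linarith [one_le_smoothCbrt V]) h1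
  have h3 : 1 ≤ smoothCbrt V / (n + 1) := (one_le_div (by positivity)).2 h2
  rw [expCbrtCutoff, max_eq_left (by linarith)]
  simp

theorem max_cutoff_antitone (n : ℕ) (V v : ℝ≥0) :
    max 0 (1 - smoothCbrt ((V : ℝ) + v) / (n + 1)) ≤ max 0 (1 - smoothCbrt V / (n + 1)) := by
  have h0 : smoothCbrt V ≤ smoothCbrt ((V : ℝ) + v) := sub_nonneg.1 (cbrtIncrement_nonneg V v)
  gcongr

theorem max_cutoff_sub_le (n : ℕ) (V v : ℝ≥0) :
    max 0 (1 - smoothCbrt V / (n + 1)) - max 0 (1 - smoothCbrt ((V : ℝ) + v) / (n + 1))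
      ≤ cbrtIncrement V v := by
  have h1 : cbrtIncrement V v / (n + 1) ≤ cbrtIncrement V v :=
    div_le_self (cbrtIncrement_nonneg V v) (by linarith [(Nat.cast_nonneg n : (0 : ℝ) ≤ n)])
  have h2 : cbrtIncrement V v / (n + 1)
      = smoothCbrt ((V : ℝ) + v) / (n + 1) - smoothCbrt V / (n + 1) := sub_div _ _ _
  have h3 := cbrtIncrement_nonneg V v
  rw [sub_le_iff_le_add]
  refine max_le ?_ ?_
  · have := le_max_left 0 (1 - smoothCbrt ((V : ℝ) + v) / (n + 1))
    linarith
  · have := le_max_right 0 (1 - smoothCbrt ((V : ℝ) + v) / (n + 1))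
    linarith

theorem expCbrtCutoff_antitone (hk : 0 ≤ k) (n : ℕ) (V v : ℝ≥0) :
    expCbrtCutoff k n ((V : ℝ) + v) ≤ expCbrtCutoff k n V :=
  mul_le_mul (expCbrt_antitone hk V v)
    (pow_le_pow_left₀ (max_cutoff_mem n _).1 (max_cutoff_antitone n V v) 2)
    (sq_nonneg _) (expCbrt_pos k V).le

/-- The constant is independent of n, which is what permits n → ∞ under the integrals: k comes from
the exponential, 2 from the square of a factor lying in [0,1]. -/
theorem collisionLipschitz_expCbrtCutoff (hk : 0 ≤ k) (n : ℕ) :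
    CollisionLipschitz (k + 2) (expCbrtCutoff k n) := by
  intro V v
  rw [abs_sub_comm, abs_of_nonneg (sub_nonneg.2 (expCbrtCutoff_antitone hk n V v))]
  have h1 := expCbrt_sub_le hk V v
  have h2 := max_cutoff_sub_le n V v
  have h3 := max_cutoff_mem n V
  have h4 := max_cutoff_mem n ((V : ℝ) + v)
  have h5 := expCbrt_antitone hk V v
  have h6 := expCbrt_le_one hk ((V : ℝ) + v)
  have h7 := expCbrt_pos k ((V : ℝ) + v)
  have h8 := max_cutoff_antitone n V v
  rw [expCbrtCutoff, expCbrtCutoff]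
  set p := max 0 (1 - smoothCbrt V / (n + 1))
  set q := max 0 (1 - smoothCbrt ((V : ℝ) + v) / (n + 1))
  set x := expCbrt k V
  set y := expCbrt k ((V : ℝ) + v)
  have a1 : (x - y) * p ^ 2 ≤ x - y :=
    mul_le_of_le_one_right (by linarith) (pow_le_one₀ h3.1 h3.2)
  have a2 : y * (p ^ 2 - q ^ 2) ≤ p ^ 2 - q ^ 2 :=
    mul_le_of_le_one_left (sub_nonneg.2 (pow_le_pow_left₀ h4.1 h8 2)) h6
  have a3 : p ^ 2 - q ^ 2 ≤ 2 * (p - q) := by nlinarith [h3.2, h4.2]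
  linarith

theorem tendsto_expCbrtCutoff (k V : ℝ) :
    Tendsto (fun n : ℕ => expCbrtCutoff k n V) atTop (𝓝 (expCbrt k V)) := by
  have h1 : Tendsto (fun n : ℕ => smoothCbrt V / ((n : ℝ) + 1)) atTop (𝓝 0) :=
    tendsto_const_nhds.div_atTop
      (tendsto_atTop_add_const_right _ _ tendsto_natCast_atTop_atTop)
  have h2 := (((tendsto_const_nhds (x := (0 : ℝ))).max (h1.const_sub 1)).pow 2).const_mul
    (expCbrt k V)
  simpa [expCbrtCutoff] using h2

end Exp

/-! ### Conservation of mass and bounded test functions -/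

section Mass

variable {G : Measure ℝ≥0} {lam k T : ℝ} {F : ℝ → Measure ℝ≥0}

/-- For k = 0 the test function is a pure cutoff, nonincreasing in V. Upward jumps can only decrease
its integral, which starts at most at 1. -/
theorem IsWeakSolution.integral_expCbrtCutoff_le (hF : IsWeakSolution lam G F) (hlam : 0 ≤ lam)
    (hG : Integrable (fun v : ℝ≥0 => (v : ℝ)) G) (hT : 0 ≤ T) (n : ℕ) :
    ∫ V : ℝ≥0, expCbrtCutoff 0 n V ∂(F T) ≤ 1 := by
  have hprob := (hF 1 one_pos).initial
  have h := hF.exp_mul_integral_sub hT hG (by norm_num) (contDiff_expCbrtCutoff 0 n)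
    (hasCompactSupport_expCbrtCutoff 0 n) (collisionLipschitz_expCbrtCutoff le_rfl n) 0
  simp only [zero_mul, Real.exp_zero, one_mul, add_zero] at h
  have h1 : ∫ s in (0 : ℝ)..T, ∫ V, adjointCollision lam G (expCbrtCutoff 0 n) V ∂(F s) ≤ 0 := by
    rw [intervalIntegral.integral_of_le hT]
    exact integral_nonpos fun s => integral_nonpos
      (adjointCollision_nonpos hlam (expCbrtCutoff_antitone le_rfl n))
  have h2 : ∫ V : ℝ≥0, expCbrtCutoff 0 n V ∂(F 0) ≤ ∫ _ : ℝ≥0, (1 : ℝ) ∂(F 0) := by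
    refine integral_mono_of_nonneg (Eventually.of_forall fun V => expCbrtCutoff_nonneg _ _ _)
      (integrable_const _) (Eventually.of_forall fun V => expCbrtCutoff_le_one le_rfl _ _)
  have h3 : ∫ _ : ℝ≥0, (1 : ℝ) ∂(F 0) = 1 := by simp
  linarith

/-- Fatou's lemma applied to the cutoffs, which tend to 1. Initially F T is only known to be finite
on compacts; from here on bounded functions can be integrated. -/
theorem IsWeakSolution.measure_univ_le (hF : IsWeakSolution lam G F) (hlam : 0 ≤ lam)
    (hG : Integrable (fun v : ℝ≥0 => (v : ℝ)) G) (hT : 0 ≤ T) : F T univ ≤ 1 := by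
  have hfin := (hF (T + 1) (by linarith)).radon T ⟨hT, by linarith⟩
  have hc : ∀ n, Continuous fun V : ℝ≥0 => expCbrtCutoff 0 n V := fun n =>
    (contDiff_expCbrtCutoff 0 n).continuous.comp (by fun_prop)
  have h1 : ∀ n, ∫⁻ V : ℝ≥0, ENNReal.ofReal (expCbrtCutoff 0 n V) ∂(F T) ≤ 1 := fun n => by
    rw [← ofReal_integral_eq_lintegral_ofReal (integrable_of_hasCompactSupport_nnreal hfin (hc n)
      (hasCompactSupport_comp_coe (hasCompactSupport_expCbrtCutoff 0 n)))
      (Eventually.of_forall fun V => expCbrtCutoff_nonneg _ _ _)]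
    exact ENNReal.ofReal_le_one.2 (hF.integral_expCbrtCutoff_le hlam hG hT n)
  calc F T univ = ∫⁻ V : ℝ≥0, liminf
        (fun n : ℕ => ENNReal.ofReal (expCbrtCutoff 0 n V)) atTop ∂(F T) := by
        rw [← setLIntegral_one, Measure.restrict_univ]
        refine lintegral_congr fun V => ?_
        have := (ENNReal.continuous_ofReal.tendsto _).comp (tendsto_expCbrtCutoff 0 V)
        rw [expCbrt, zero_mul, neg_zero, Real.exp_zero, ENNReal.ofReal_one] at this
        exact this.liminf_eq.symm
    _ ≤ liminf (fun n : ℕ => ∫⁻ V : ℝ≥0, ENNReal.ofReal (expCbrtCutoff 0 n V) ∂(F T)) atTop :=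
        lintegral_liminf_le fun n => (ENNReal.continuous_ofReal.comp (hc n)).measurable
    _ ≤ 1 := by
        refine (liminf_le_liminf (Eventually.of_forall h1)).trans ?_
        simp

theorem IsWeakSolution.isFiniteMeasure (hF : IsWeakSolution lam G F) (hlam : 0 ≤ lam)
    (hG : Integrable (fun v : ℝ≥0 => (v : ℝ)) G) (hT : 0 ≤ T) : IsFiniteMeasure (F T) :=
  ⟨(hF.measure_univ_le hlam hG hT).trans_lt ENNReal.one_lt_top⟩

theorem IsWeakSolution.abs_integral_le (hF : IsWeakSolution lam G F) (hlam : 0 ≤ lam)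
    (hG : Integrable (fun v : ℝ≥0 => (v : ℝ)) G) (hT : 0 ≤ T) {g : ℝ≥0 → ℝ} {C : ℝ}
    (hg : ∀ V, |g V| ≤ C) : |∫ V, g V ∂(F T)| ≤ C := by
  have hfin := hF.isFiniteMeasure hlam hG hT
  have h1 := norm_integral_le_of_norm_le_const (μ := F T) (f := g) (Eventually.of_forall hg)
  have h2 : (F T).real univ ≤ 1 := by
    have := ENNReal.toReal_mono ENNReal.one_ne_top (hF.measure_univ_le hlam hG hT)
    simpa [Measure.real] using this
  have h3 : 0 ≤ C := (abs_nonneg _).trans (hg 0)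
  exact h1.trans (mul_le_of_le_one_right h3 h2)

/-- Weak-* continuity covers only compactly supported functions; for bounded g the time dependence
is a pointwise limit of continuous functions. -/
theorem IsWeakSolution.aestronglyMeasurable (hF : IsWeakSolution lam G F) (hlam : 0 ≤ lam)
    (hG : Integrable (fun v : ℝ≥0 => (v : ℝ)) G) (hT : 0 < T) {g : ℝ≥0 → ℝ} {C : ℝ}
    (hgc : Continuous g) (hg : ∀ V, |g V| ≤ C) :
    AEStronglyMeasurable (fun s => ∫ V, g V ∂(F s)) (volume.restrict (Ioc 0 T)) := by
  have hc : ∀ n, Continuous fun V : ℝ≥0 => expCbrtCutoff 0 n V * g V := fun n =>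
    ((contDiff_expCbrtCutoff 0 n).continuous.comp (by fun_prop)).mul hgc
  refine aestronglyMeasurable_of_tendsto_ae atTop
    (f := fun (n : ℕ) s => ∫ V : ℝ≥0, expCbrtCutoff 0 n V * g V ∂(F s)) (fun n => ?_) ?_
  · refine ContinuousOn.aestronglyMeasurable ?_ measurableSet_Ioc
    exact ((hF T hT).continuousOn _ (hc n) ((hasCompactSupport_comp_coe
      (hasCompactSupport_expCbrtCutoff 0 n)).mul_right)).mono Ioc_subset_Icc_self
  · filter_upwards [ae_restrict_mem measurableSet_Ioc] with s hs
    have hfin := hF.isFiniteMeasure hlam hG hs.1.le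
    refine tendsto_integral_of_dominated_convergence (fun _ => C)
      (fun n => (hc n).aestronglyMeasurable) (integrable_const _)
      (fun n => Eventually.of_forall fun V => ?_) (Eventually.of_forall fun V => ?_)
    · rw [Real.norm_eq_abs, abs_mul, abs_of_nonneg (expCbrtCutoff_nonneg _ _ _)]
      have h1 := expCbrtCutoff_le_one (le_refl (0 : ℝ)) n V
      exact (mul_le_of_le_one_left (abs_nonneg _) h1).trans (hg V)
    · simpa [expCbrt] using (tendsto_expCbrtCutoff 0 V).mul_const (g V)

theorem IsWeakSolution.intervalIntegrable (hF : IsWeakSolution lam G F) (hlam : 0 ≤ lam)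
    (hG : Integrable (fun v : ℝ≥0 => (v : ℝ)) G) (hT : 0 < T) {g : ℝ≥0 → ℝ} {C : ℝ}
    (hgc : Continuous g) (hg : ∀ V, |g V| ≤ C) :
    IntervalIntegrable (fun s => ∫ V, g V ∂(F s)) volume 0 T := by
  rw [intervalIntegrable_iff_integrableOn_Ioc_of_le hT.le]
  refine Integrable.mono' (integrable_const C) (hF.aestronglyMeasurable hlam hG hT hgc hg) ?_
  filter_upwards [ae_restrict_mem measurableSet_Ioc] with s hs
  exact hF.abs_integral_le hlam hG hs.1.le hg

theorem IsWeakSolution.tendsto_integral (hF : IsWeakSolution lam G F) (hlam : 0 ≤ lam)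
    (hG : Integrable (fun v : ℝ≥0 => (v : ℝ)) G) (hT : 0 ≤ T) {f : ℕ → ℝ≥0 → ℝ} {g : ℝ≥0 → ℝ}
    {C : ℝ} (hc : ∀ n, Continuous (f n)) (hb : ∀ n V, |f n V| ≤ C)
    (hlim : ∀ V, Tendsto (fun n => f n V) atTop (𝓝 (g V))) :
    Tendsto (fun n => ∫ V, f n V ∂(F T)) atTop (𝓝 (∫ V, g V ∂(F T))) := by
  have hfin := hF.isFiniteMeasure hlam hG hT
  exact tendsto_integral_of_dominated_convergence (fun _ => C)
      (fun n => (hc n).aestronglyMeasurable) (integrable_const _)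
      (fun n => Eventually.of_forall (hb n)) (Eventually.of_forall hlim)

/-- Dominated convergence in V and then in s removes the cutoff, using mass at most 1 and the bound
on the operator uniform in n. -/
theorem IsWeakSolution.exp_mul_integral_expCbrt_sub (hF : IsWeakSolution lam G F)
    (hlam : 0 ≤ lam) (hG : Integrable (fun v : ℝ≥0 => (v : ℝ)) G) (hT : 0 < T) (hk : 0 ≤ k)
    (b : ℝ) :
    Real.exp (b * T) * ∫ V : ℝ≥0, expCbrt k V ∂(F T) - ∫ V : ℝ≥0, expCbrt k V ∂(F 0)
      = ∫ s in (0 : ℝ)..T, Real.exp (b * s) * ((∫ V, adjointCollision lam G (expCbrt k) V ∂(F s))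
        + b * ∫ V : ℝ≥0, expCbrt k V ∂(F s)) := by
  have hL : 0 ≤ k + 2 := by linarith
  have hc : ∀ n, Continuous fun V : ℝ≥0 => expCbrtCutoff k n V := fun n =>
    (contDiff_expCbrtCutoff k n).continuous.comp (by fun_prop)
  have hb : ∀ n, ∀ V : ℝ≥0, |expCbrtCutoff k n V| ≤ 1 := fun n V => by
    rw [abs_of_nonneg (expCbrtCutoff_nonneg _ _ _)]
    exact expCbrtCutoff_le_one hk n V
  have hlip := collisionLipschitz_expCbrtCutoff hk
  have hcont := fun n => (contDiff_expCbrtCutoff k n).continuous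
  have hAc : ∀ n, Continuous (adjointCollision lam G (expCbrtCutoff k n)) := fun n =>
    (hlip n).continuous_adjointCollision hG hL (hcont n)
  set C := lam * (4 * (k + 2) * ∫ v : ℝ≥0, (v : ℝ) ∂G) with hC
  have hAb : ∀ n V, |adjointCollision lam G (expCbrtCutoff k n) V| ≤ C := fun n V =>
    (hlip n).abs_adjointCollision_le hG hlam hL V
  have l1 : ∀ s, 0 ≤ s → Tendsto (fun n => ∫ V : ℝ≥0, expCbrtCutoff k n V ∂(F s)) atTop
      (𝓝 (∫ V : ℝ≥0, expCbrt k V ∂(F s))) := fun s hs =>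
    hF.tendsto_integral hlam hG hs hc hb fun V => tendsto_expCbrtCutoff k V
  have l2 : ∀ s, 0 ≤ s →
      Tendsto (fun n => ∫ V, adjointCollision lam G (expCbrtCutoff k n) V ∂(F s)) atTop
      (𝓝 (∫ V, adjointCollision lam G (expCbrt k) V ∂(F s))) := fun s hs =>
    hF.tendsto_integral hlam hG hs hAc hAb
      (tendsto_adjointCollision hG hL hlip hcont fun V => tendsto_expCbrtCutoff k V)
  have lhs := ((l1 T hT.le).const_mul (Real.exp (b * T))).sub (l1 0 le_rfl)
  refine tendsto_nhds_unique lhs ?_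
  simp only [fun n => hF.exp_mul_integral_sub hT.le hG hL (contDiff_expCbrtCutoff k n)
    (hasCompactSupport_expCbrtCutoff k n) (hlip n) b]
  refine intervalIntegral.tendsto_integral_filter_of_dominated_convergence
    (fun s => Real.exp (b * s) * (C + |b|)) (Eventually.of_forall fun n => ?_)
    (Eventually.of_forall fun n => Eventually.of_forall fun s hs => ?_)
    (Continuous.intervalIntegrable (by fun_prop) _ _)
    (Eventually.of_forall fun s hs => ?_)
  · rw [uIoc_of_le hT.le]
    exact (Continuous.aestronglyMeasurable (by fun_prop)).mul
      ((hF.aestronglyMeasurable hlam hG hT (hAc n) (hAb n)).add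
        ((hF.aestronglyMeasurable hlam hG hT (hc n) (hb n)).const_mul b))
  · rw [uIoc_of_le hT.le] at hs
    rw [Real.norm_eq_abs, abs_mul, Real.abs_exp]
    have h1 := hF.abs_integral_le hlam hG hs.1.le (hAb n)
    have h2 := hF.abs_integral_le hlam hG hs.1.le (hb n)
    gcongr
    refine (abs_add_le _ _).trans (add_le_add h1 ?_)
    rw [abs_mul]
    exact mul_le_of_le_one_right (abs_nonneg b) h2
  · rw [uIoc_of_le hT.le] at hs
    exact ((l2 s hs.1.le).add ((l1 s hs.1.le).const_mul b)).const_mul _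

/-- With k = 0 the test function is the constant 1, which the adjoint operator annihilates. -/
theorem IsWeakSolution.isProbabilityMeasure (hF : IsWeakSolution lam G F)
    (hlam : 0 ≤ lam) (hG : Integrable (fun v : ℝ≥0 => (v : ℝ)) G) (hT : 0 ≤ T) :
    IsProbabilityMeasure (F T) := by
  have hprob := (hF 1 one_pos).initial
  rcases hT.eq_or_lt with rfl | hT'
  · exact hprob
  have hfin := hF.isFiniteMeasure hlam hG hT
  have h := hF.exp_mul_integral_expCbrt_sub hlam hG hT' le_rfl 0
  have e : expCbrt 0 = fun _ => 1 := by
    ext V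
    simp [expCbrt]
  have hA : ∀ V, adjointCollision lam G (fun _ => 1) V = 0 := fun V => by
    simp [adjointCollision]
  simp only [e, hA] at h
  simp only [zero_mul, Real.exp_zero, integral_const, smul_eq_mul, mul_one, one_mul, mul_zero,
    add_zero, probReal_univ, intervalIntegral.integral_zero] at h
  rw [isProbabilityMeasure_iff_real]
  linarith

end Mass

/-! ### Error estimates and the limit of the Laplace transforms -/

theorem abs_exp_neg_sub_le {y : ℝ} (hy : 0 ≤ y) :
    |Real.exp (-y) - 1 + y| ≤ y * min 1 y := by
  have h1 := Real.add_one_le_exp (-y)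
  have h2 : Real.exp (-y) ≤ 1 := Real.exp_le_one_iff.2 (by linarith)
  rw [abs_of_nonneg (by linarith)]
  rcases le_total y 1 with h | h
  · rw [min_eq_right h]
    have h3 := (abs_le.1 (Real.abs_exp_sub_one_sub_id_le
      (show |-y| ≤ 1 by rwa [abs_neg, abs_of_nonneg hy]))).2
    nlinarith
  · rw [min_eq_left h]
    linarith

/-- Bound for the second order terms in the expansion of the adjoint collision operator. -/
def quadraticError (G : Measure ℝ≥0) (ε : ℝ) : ℝ :=
  ∫ v : ℝ≥0, 4 * (v : ℝ) * min 1 (ε * v) ∂G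

/-- Deviation of the mean increment of `smoothCbrt` from its limit at infinity. -/
def driftError (G : Measure ℝ≥0) (V : ℝ≥0) : ℝ :=
  ∫ v : ℝ≥0, |collisionRate V v * cbrtIncrement V v - v / 3| ∂G

section Asymptotics

variable {G : Measure ℝ≥0} {lam k T : ℝ} {F : ℝ → Measure ℝ≥0}

theorem continuous_collisionRate_mul_increment (V : ℝ≥0) :
    Continuous fun v : ℝ≥0 => collisionRate V v * cbrtIncrement V v :=
  (continuous_collisionRate_mul contDiff_smoothCbrt.continuous).comp (by fun_prop :
    Continuous fun v : ℝ≥0 => (V, v))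

theorem abs_drift_le (V v : ℝ≥0) :
    |collisionRate V v * cbrtIncrement V v - v / 3| ≤ 5 * v := by
  have h1 := collisionRate_mul_cbrtIncrement_le V v
  have h2 := mul_nonneg (collisionRate_nonneg V v) (cbrtIncrement_nonneg V v)
  have h3 : (0 : ℝ) ≤ v := v.2
  rw [abs_le]
  constructor <;> linarith

theorem integrable_drift (hG : Integrable (fun v : ℝ≥0 => (v : ℝ)) G) (V : ℝ≥0) :
    Integrable (fun v : ℝ≥0 => |collisionRate V v * cbrtIncrement V v - v / 3|) G := by
  have hc := continuous_collisionRate_mul_increment V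
  refine (hG.const_mul 5).mono' (Continuous.aestronglyMeasurable (by fun_prop))
    (Eventually.of_forall fun v => ?_)
  rw [Real.norm_eq_abs, abs_abs]
  exact abs_drift_le V v

theorem driftError_le (hG : Integrable (fun v : ℝ≥0 => (v : ℝ)) G) (V : ℝ≥0) :
    driftError G V ≤ 5 * ∫ v : ℝ≥0, (v : ℝ) ∂G := by
  rw [← integral_const_mul]
  exact integral_mono (integrable_drift hG V) (hG.const_mul 5) (abs_drift_le V)

theorem tendsto_driftError (hG : Integrable (fun v : ℝ≥0 => (v : ℝ)) G) :
    Tendsto (driftError G) atTop (𝓝 0) := by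
  have := tendsto_integral_filter_of_dominated_convergence (μ := G) (l := atTop)
    (F := fun V v : ℝ≥0 => |collisionRate V v * cbrtIncrement V v - v / 3|) (f := fun _ => 0)
    (fun v : ℝ≥0 => 5 * (v : ℝ))
    (Eventually.of_forall fun V => (integrable_drift hG V).aestronglyMeasurable)
    (Eventually.of_forall fun V => Eventually.of_forall fun v => ?_) (hG.const_mul 5)
    (Eventually.of_forall fun v => ?_)
  · rw [integral_zero] at this
    exact this
  · rw [Real.norm_eq_abs, abs_abs]
    exact abs_drift_le V v
  · simpa using ((tendsto_collisionRate_mul_cbrtIncrement v).sub_const ((v : ℝ) / 3)).abs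

theorem abs_quadratic_le {ε : ℝ} (hε : 0 ≤ ε) (v : ℝ≥0) :
    |4 * (v : ℝ) * min 1 (ε * v)| ≤ 4 * v := by
  have h : 0 ≤ min 1 (ε * v) := le_min zero_le_one (by positivity)
  rw [abs_of_nonneg (by positivity)]
  exact mul_le_of_le_one_right (by positivity) (min_le_left _ _)

theorem integrable_quadratic (hG : Integrable (fun v : ℝ≥0 => (v : ℝ)) G) {ε : ℝ}
    (hε : 0 ≤ ε) : Integrable (fun v : ℝ≥0 => 4 * (v : ℝ) * min 1 (ε * v)) G :=
  (hG.const_mul 4).mono' (Continuous.aestronglyMeasurable (by fun_prop))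
    (Eventually.of_forall (abs_quadratic_le hε))

theorem tendsto_div_atTop_zero (k : ℝ) : Tendsto (fun T : ℝ => k / T) atTop (𝓝 0) :=
  tendsto_const_nhds.div_atTop tendsto_id

/-- The truncation `min 1` keeps the integrand below 4v, so dominated convergence needs no second
moment of G. -/
theorem tendsto_quadraticError (hG : Integrable (fun v : ℝ≥0 => (v : ℝ)) G) (hk : 0 ≤ k) :
    Tendsto (fun T : ℝ => quadraticError G (k / T)) atTop (𝓝 0) := by
  have := tendsto_integral_filter_of_dominated_convergence (μ := G) (l := atTop)
    (F := fun (T : ℝ) (v : ℝ≥0) => 4 * (v : ℝ) * min 1 (k / T * v)) (f := fun _ => 0)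
    (fun v : ℝ≥0 => 4 * (v : ℝ))
    (Eventually.of_forall fun V => Continuous.aestronglyMeasurable (by fun_prop))
    (by
      filter_upwards [eventually_ge_atTop 0] with T hT
      exact Eventually.of_forall (abs_quadratic_le (div_nonneg hk hT))) (hG.const_mul 4)
    (Eventually.of_forall fun v => ?_)
  · rw [integral_zero] at this
    exact this
  · simpa using ((tendsto_const_nhds (x := (1 : ℝ))).min
      ((tendsto_div_atTop_zero k).mul_const (v : ℝ))).const_mul (4 * (v : ℝ))

/-- Expand the exponential of the increment to first order. The remainder gives `quadraticError`;
replacing rate times increment by its limit v/3 gives `driftError`. -/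
theorem abs_adjointCollision_expCbrt_add_le (hlam : 0 ≤ lam)
    (hG : Integrable (fun v : ℝ≥0 => (v : ℝ)) G) {ε : ℝ} (hε : 0 ≤ ε) (V : ℝ≥0) :
    |adjointCollision lam G (expCbrt ε) V
      + ε * (lam * (∫ v : ℝ≥0, (v : ℝ) ∂G) / 3) * expCbrt ε V|
      ≤ lam * (ε * (quadraticError G ε + driftError G V)) := by
  have i1 := (collisionLipschitz_expCbrt hε).integrable hG hε (continuous_expCbrt ε) V
  have i2 := hG.const_mul (ε / 3 * expCbrt ε V)
  have e : adjointCollision lam G (expCbrt ε) V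
      + ε * (lam * (∫ v : ℝ≥0, (v : ℝ) ∂G) / 3) * expCbrt ε V
      = lam * ∫ v : ℝ≥0, (collisionRate V v * (expCbrt ε ((V : ℝ) + v) - expCbrt ε V)
        + ε / 3 * expCbrt ε V * v) ∂G := by
    rw [integral_add i1 i2, integral_const_mul, adjointCollision_eq]
    ring
  rw [e, abs_mul, abs_of_nonneg hlam, quadraticError, driftError,
    ← integral_add (integrable_quadratic hG hε) (integrable_drift hG V), ← integral_const_mul]
  refine mul_le_mul_of_nonneg_left ?_ hlam
  rw [← Real.norm_eq_abs]
  refine norm_integral_le_of_norm_le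
    (((integrable_quadratic hG hε).add (integrable_drift hG V)).const_mul ε)
    (Eventually.of_forall fun v => ?_)
  rw [Real.norm_eq_abs, expCbrt_add]
  have hr := collisionRate_nonneg V v
  have hd := cbrtIncrement_nonneg V v
  have hy : 0 ≤ ε * cbrtIncrement V v := mul_nonneg hε hd
  have b1 := abs_exp_neg_sub_le hy
  have b2 : min 1 (ε * cbrtIncrement V v) ≤ min 1 (ε * v) :=
    min_le_min_left _ (mul_le_mul_of_nonneg_left (cbrtIncrement_le_self V v) hε)
  have b3 : 0 ≤ min 1 (ε * cbrtIncrement V v) := le_min zero_le_one hy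
  have b4 := collisionRate_mul_cbrtIncrement_le V v
  have b5 : collisionRate V v * |Real.exp (-(ε * cbrtIncrement V v)) - 1 + ε * cbrtIncrement V v|
      ≤ ε * (4 * v * min 1 (ε * v)) := by
    calc _ ≤ collisionRate V v * (ε * cbrtIncrement V v * min 1 (ε * cbrtIncrement V v)) :=
          mul_le_mul_of_nonneg_left b1 hr
      _ = ε * (collisionRate V v * cbrtIncrement V v * min 1 (ε * cbrtIncrement V v)) := by ring
      _ ≤ ε * (4 * v * min 1 (ε * v)) := by
          refine mul_le_mul_of_nonneg_left ?_ hε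
          exact mul_le_mul b4 b2 b3 (by positivity)
  have e2 : collisionRate V v * (expCbrt ε V * Real.exp (-(ε * cbrtIncrement V v)) - expCbrt ε V)
      + ε / 3 * expCbrt ε V * v
      = expCbrt ε V * (collisionRate V v
        * (Real.exp (-(ε * cbrtIncrement V v)) - 1 + ε * cbrtIncrement V v)
        - ε * (collisionRate V v * cbrtIncrement V v - v / 3)) := by ring
  rw [e2, abs_mul, abs_of_pos (expCbrt_pos ε V)]
  refine (mul_le_of_le_one_left (abs_nonneg _) (expCbrt_le_one hε V)).trans ?_
  refine (abs_sub _ _).trans ?_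
  rw [abs_mul, abs_mul, abs_of_nonneg hr, abs_of_nonneg hε]
  linarith

theorem neg_adjointCollision_expCbrt_pos (hlam : 0 < lam)
    (hG : Integrable (fun v : ℝ≥0 => (v : ℝ)) G) (hm : 0 < ∫ v : ℝ≥0, (v : ℝ) ∂G) (V : ℝ≥0) :
    0 < -adjointCollision lam G (expCbrt 1) V := by
  have i1 := ((collisionLipschitz_expCbrt zero_le_one).integrable hG zero_le_one
    (continuous_expCbrt 1) V).neg
  rw [adjointCollision_eq, ← mul_neg, ← integral_neg]
  refine mul_pos hlam (lt_of_le_of_ne ?_ fun h0 => hm.ne' ?_)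
  · refine integral_nonneg fun v => ?_
    rw [Pi.zero_apply, neg_nonneg]
    exact mul_nonpos_of_nonneg_of_nonpos (collisionRate_nonneg V v)
      (sub_nonpos.2 (expCbrt_antitone zero_le_one V v))
  · have hnn : 0 ≤ fun v : ℝ≥0 =>
        -(collisionRate V v * (expCbrt 1 ((V : ℝ) + v) - expCbrt 1 V)) := fun v => by
      rw [Pi.zero_apply, neg_nonneg]
      exact mul_nonpos_of_nonneg_of_nonpos (collisionRate_nonneg V v)
        (sub_nonpos.2 (expCbrt_antitone zero_le_one V v))
    have hz := (integral_eq_zero_iff_of_nonneg hnn i1).1 h0.symm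
    refine integral_eq_zero_of_ae ?_
    filter_upwards [hz] with v hv
    by_contra hne
    have hvpos : (0 : ℝ) < v := lt_of_le_of_ne v.2 (Ne.symm hne)
    have h1 : 0 < collisionRate V v := by
      have h2 : 0 < (v : ℝ) ^ (1 / 3 : ℝ) := Real.rpow_pos_of_pos hvpos _
      have h3 : 0 ≤ (V : ℝ) ^ (1 / 3 : ℝ) := by positivity
      rw [collisionRate]
      positivity
    have h2 : 0 < cbrtIncrement V v :=
      sub_pos.2 (smoothCbrt_strictMono V.2 (by simpa using hvpos))
    have h3 : expCbrt 1 ((V : ℝ) + v) < expCbrt 1 V := by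
      rw [expCbrt_add]
      refine mul_lt_of_lt_one_right (expCbrt_pos 1 V) (Real.exp_lt_one_iff.2 ?_)
      linarith
    have h4 := mul_neg_of_pos_of_neg h1 (sub_neg.2 h3)
    simp only [Pi.zero_apply, neg_eq_zero] at hv
    linarith

/-- The drift error is below η for V ≥ K, and on [0,K] the dissipation of exp(-X) is continuous and
strictly positive, so a multiple of it dominates the uniform bound 5m. If m = 0 the drift error is
already nonpositive. -/
theorem exists_driftError_le (hlam : 0 < lam) (hG : Integrable (fun v : ℝ≥0 => (v : ℝ)) G)
    {η : ℝ} (hη : 0 < η) :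
    ∃ C : ℝ, 0 ≤ C ∧ ∀ V, driftError G V ≤ η + C * -adjointCollision lam G (expCbrt 1) V := by
  have hm0 : 0 ≤ ∫ v : ℝ≥0, (v : ℝ) ∂G := integral_nonneg fun v => v.2
  rcases hm0.eq_or_lt with hm | hm
  · refine ⟨0, le_rfl, fun V => ?_⟩
    have := driftError_le hG V
    rw [← hm] at this
    linarith
  have hpos := neg_adjointCollision_expCbrt_pos hlam hG hm
  obtain ⟨K, hK⟩ := eventually_atTop.1 ((tendsto_driftError hG).eventually (gt_mem_nhds hη))
  have hcont : Continuous fun V => -adjointCollision lam G (expCbrt 1) V :=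
    ((collisionLipschitz_expCbrt zero_le_one).continuous_adjointCollision hG zero_le_one
      (continuous_expCbrt 1)).neg
  obtain ⟨V₀, -, hV₀⟩ := (isCompact_Icc (a := 0) (b := K)).exists_isMinOn
    ⟨0, le_rfl, zero_le⟩ hcont.continuousOn
  refine ⟨5 * (∫ v : ℝ≥0, (v : ℝ) ∂G) / -adjointCollision lam G (expCbrt 1) V₀,
    div_nonneg (by positivity) (hpos V₀).le, fun V => ?_⟩
  have hC : 0 ≤ 5 * (∫ v : ℝ≥0, (v : ℝ) ∂G) / -adjointCollision lam G (expCbrt 1) V₀ :=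
    div_nonneg (by positivity) (hpos V₀).le
  rcases le_total K V with h | h
  · have := mul_nonneg hC (hpos V).le
    have := hK V h
    linarith
  · have h1 : -adjointCollision lam G (expCbrt 1) V₀ ≤ -adjointCollision lam G (expCbrt 1) V :=
      hV₀ ⟨zero_le, h⟩
    have h2 := mul_le_mul_of_nonneg_left h1 hC
    rw [div_mul_cancel₀ _ (hpos V₀).ne'] at h2
    have := driftError_le hG V
    linarith

/-- The accumulated dissipation is the total loss of ∫ exp(-X) dF, which lies in [0,1]. It limits
the time spent at bounded volumes, uniformly in T. -/
theorem IsWeakSolution.integral_neg_adjointCollision_le (hF : IsWeakSolution lam G F)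
    (hlam : 0 ≤ lam) (hG : Integrable (fun v : ℝ≥0 => (v : ℝ)) G) (hT : 0 < T) :
    ∫ s in (0 : ℝ)..T, ∫ V, -adjointCollision lam G (expCbrt 1) V ∂(F s) ≤ 1 := by
  have h := hF.exp_mul_integral_expCbrt_sub hlam hG hT zero_le_one 0
  simp only [zero_mul, Real.exp_zero, one_mul, add_zero] at h
  simp only [integral_neg, intervalIntegral.integral_neg]
  rw [← h]
  have h1 := hF.abs_integral_le hlam hG le_rfl (g := fun V => expCbrt 1 V) (C := 1) fun V => by
    rw [abs_of_pos (expCbrt_pos _ _)]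
    exact expCbrt_le_one zero_le_one V
  have h2 : 0 ≤ ∫ V : ℝ≥0, expCbrt 1 V ∂(F T) := integral_nonneg fun V => (expCbrt_pos 1 V).le
  have h3 := (abs_le.1 h1).2
  linarith

/-- With b = εc only the error terms remain. Over a time T the bounded ones contribute εT = k times
their size, while the dissipation contributes at most εC = kC/T. -/
theorem IsWeakSolution.abs_exp_mul_integral_sub_le (hF : IsWeakSolution lam G F)
    (hlam : 0 ≤ lam) (hG : Integrable (fun v : ℝ≥0 => (v : ℝ)) G) (hT : 0 < T) (hk : 0 ≤ k)
    {η C : ℝ} (hC0 : 0 ≤ C)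
    (hC : ∀ V, driftError G V ≤ η + C * -adjointCollision lam G (expCbrt 1) V) :
    |Real.exp (k * (lam * (∫ v : ℝ≥0, (v : ℝ) ∂G) / 3)) * ∫ V : ℝ≥0, expCbrt (k / T) V ∂(F T)
      - ∫ V : ℝ≥0, expCbrt (k / T) V ∂(F 0)|
      ≤ Real.exp (k * (lam * (∫ v : ℝ≥0, (v : ℝ) ∂G) / 3)) * (lam * k)
        * (quadraticError G (k / T) + η + C / T) := by
  set c := lam * (∫ v : ℝ≥0, (v : ℝ) ∂G) / 3 with hc
  have hc0 : 0 ≤ c := by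
    have : 0 ≤ ∫ v : ℝ≥0, (v : ℝ) ∂G := integral_nonneg fun v => v.2
    positivity
  set ε := k / T with hε
  have hε0 : 0 ≤ ε := div_nonneg hk hT.le
  have hεT : ε * c * T = k * c := by
    rw [hε]
    field_simp
  have h := hF.exp_mul_integral_expCbrt_sub hlam hG hT hε0 (ε * c)
  rw [hεT] at h
  rw [h]
  set g : ℝ≥0 → ℝ := fun V => -adjointCollision lam G (expCbrt 1) V with hg
  have gc : Continuous g :=
    ((collisionLipschitz_expCbrt zero_le_one).continuous_adjointCollision hG zero_le_one
      (continuous_expCbrt 1)).neg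
  have gb : ∀ V, |g V| ≤ lam * (4 * 1 * ∫ v : ℝ≥0, (v : ℝ) ∂G) := fun V => by
    rw [hg, abs_neg]
    exact (collisionLipschitz_expCbrt zero_le_one).abs_adjointCollision_le hG hlam zero_le_one V
  have gi := hF.intervalIntegrable hlam hG hT gc gb
  have lip := collisionLipschitz_expCbrt hε0
  have Ac := lip.continuous_adjointCollision (lam := lam) hG hε0 (continuous_expCbrt ε)
  have Ab := lip.abs_adjointCollision_le hG hlam hε0
  set Q := quadraticError G ε
  have bound : ∀ s ∈ Ioc 0 T, ‖Real.exp (ε * c * s) *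
      ((∫ V, adjointCollision lam G (expCbrt ε) V ∂(F s))
        + ε * c * ∫ V : ℝ≥0, expCbrt ε V ∂(F s))‖
      ≤ Real.exp (k * c) * (lam * ε) * ((Q + η) + C * ∫ V, g V ∂(F s)) := by
    intro s hs
    have hprob := hF.isProbabilityMeasure hlam hG hs.1.le
    have ig : Integrable g (F s) := (integrable_const _).mono' gc.aestronglyMeasurable
      (Eventually.of_forall gb)
    have iA : Integrable (adjointCollision lam G (expCbrt ε)) (F s) :=
      (integrable_const _).mono' Ac.aestronglyMeasurable (Eventually.of_forall Ab)
    have iψ : Integrable (fun V : ℝ≥0 => expCbrt ε V) (F s) := by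
      refine (integrable_const 1).mono'
        ((continuous_expCbrt ε).comp (by fun_prop)).aestronglyMeasurable
        (Eventually.of_forall fun V => ?_)
      rw [Real.norm_eq_abs, abs_of_pos (expCbrt_pos _ _)]
      exact expCbrt_le_one hε0 V
    rw [Real.norm_eq_abs, abs_mul, Real.abs_exp, ← integral_const_mul, ← integral_add iA
      (iψ.const_mul _), mul_assoc (Real.exp (k * c))]
    refine mul_le_mul ?_ ?_ (abs_nonneg _) (Real.exp_pos _).le
    · rw [Real.exp_le_exp, ← hεT]
      exact mul_le_mul_of_nonneg_left hs.2 (mul_nonneg hε0 hc0)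
    · have e : lam * ε * ((Q + η) + C * ∫ V, g V ∂(F s))
          = ∫ V, lam * ε * ((Q + η) + C * g V) ∂(F s) := by
        rw [integral_const_mul, integral_add (integrable_const _) (ig.const_mul _),
          integral_const_mul, integral_const, probReal_univ, one_smul]
      rw [e, ← Real.norm_eq_abs]
      refine norm_integral_le_of_norm_le
        (((integrable_const _).add (ig.const_mul _)).const_mul _)
        (Eventually.of_forall fun V => ?_)
      refine (abs_adjointCollision_expCbrt_add_le hlam hG hε0 V).trans ?_
      rw [← mul_assoc]
      refine mul_le_mul_of_nonneg_left ?_ (mul_nonneg hlam hε0)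
      have := hC V
      linarith
  have ib : IntervalIntegrable (fun s => Real.exp (k * c) * (lam * ε) *
      ((Q + η) + C * ∫ V, g V ∂(F s))) volume 0 T :=
    ((intervalIntegrable_const).add (gi.const_mul C)).const_mul _
  refine (intervalIntegral.norm_integral_le_of_norm_le hT.le
    (Eventually.of_forall bound) ib).trans ?_
  rw [intervalIntegral.integral_const_mul, intervalIntegral.integral_add
    intervalIntegrable_const (gi.const_mul C), intervalIntegral.integral_const,
    intervalIntegral.integral_const_mul]
  have hle := mul_le_mul_of_nonneg_left (hF.integral_neg_adjointCollision_le hlam hG hT) hC0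
  rw [sub_zero, smul_eq_mul]
  calc _ ≤ Real.exp (k * c) * (lam * ε) * (T * (Q + η) + C * 1) := by gcongr
    _ = _ := by
      rw [hε]
      field_simp

theorem IsWeakSolution.tendsto_exp_mul_integral (hF : IsWeakSolution lam G F)
    (hlam : 0 < lam) (hG : Integrable (fun v : ℝ≥0 => (v : ℝ)) G) (hk : 0 ≤ k) :
    Tendsto (fun T => ∫ V : ℝ≥0, expCbrt (k / T) V ∂(F T)) atTop
      (𝓝 (Real.exp (-(k * (lam * (∫ v : ℝ≥0, (v : ℝ) ∂G) / 3))))) := by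
  set c := lam * (∫ v : ℝ≥0, (v : ℝ) ∂G) / 3 with hc
  have hprob := (hF 1 one_pos).initial
  have h0 : Tendsto (fun T => ∫ V : ℝ≥0, expCbrt (k / T) V ∂(F 0)) atTop (𝓝 1) := by
    have := tendsto_integral_filter_of_dominated_convergence (μ := F 0) (l := atTop)
      (F := fun (T : ℝ) (V : ℝ≥0) => expCbrt (k / T) V) (f := fun _ => 1) (fun _ => 1)
      (Eventually.of_forall fun T =>
        ((continuous_expCbrt _).comp (by fun_prop)).aestronglyMeasurable)
      (by
        filter_upwards [eventually_ge_atTop 0] with T hT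
        refine Eventually.of_forall fun V => ?_
        rw [Real.norm_eq_abs, abs_of_pos (expCbrt_pos _ _)]
        exact expCbrt_le_one (div_nonneg hk hT) V) (integrable_const _)
      (Eventually.of_forall fun V => by
        have := (Real.continuous_exp.tendsto _).comp
          (((tendsto_div_atTop_zero k).mul_const (smoothCbrt V)).neg)
        simpa [expCbrt, Function.comp_def] using this)
    simpa using this
  have h1 : Tendsto (fun T => Real.exp (k * c) * ∫ V : ℝ≥0, expCbrt (k / T) V ∂(F T)
      - ∫ V : ℝ≥0, expCbrt (k / T) V ∂(F 0)) atTop (𝓝 0) := by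
    set K := Real.exp (k * c) * (lam * k)
    have hK : 0 ≤ K := by positivity
    rw [Metric.tendsto_nhds]
    intro δ hδ
    -- This makes Kη < δ, with K + 1 in place of K because K may vanish.
    set η := δ / (2 * (K + 1)) with hη
    have hη0 : 0 < η := by positivity
    obtain ⟨C, hC0, hC⟩ := exists_driftError_le hlam hG hη0
    have hlim : Tendsto (fun T => K * (quadraticError G (k / T) + η + C / T)) atTop
        (𝓝 (K * (0 + η + 0))) :=
      (((tendsto_quadraticError hG hk).add_const η).add (tendsto_div_atTop_zero C)).const_mul K
    have hlt : K * (0 + η + 0) < δ := by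
      have : η * (2 * (K + 1)) = δ := by
        rw [hη]
        field_simp
      nlinarith
    filter_upwards [hlim.eventually (gt_mem_nhds hlt), eventually_gt_atTop 0] with T hT hT0
    rw [Real.dist_eq, sub_zero]
    exact (hF.abs_exp_mul_integral_sub_le hlam.le hG hT0 hk hC0 hC).trans_lt hT
  have h2 := (h1.add h0).const_mul (Real.exp (-(k * c)))
  rw [zero_add, mul_one] at h2
  refine h2.congr fun T => ?_
  rw [sub_add_cancel, ← mul_assoc, ← Real.exp_add]
  simp

end Asymptotics

/-! ### Concentration and the weak-* limit -/

theorem expCbrt_inv_sq (T V : ℝ) : expCbrt (1 / T) V ^ 2 = expCbrt (2 / T) V := by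
  rw [expCbrt, expCbrt, ← Real.exp_nat_mul]
  congr 1
  push_cast
  ring

theorem neg_log_expCbrt (k V : ℝ) : -Real.log (expCbrt k V) = k * smoothCbrt V := by
  rw [expCbrt, Real.log_exp, neg_neg]

/-- Chebyshev's inequality in pointwise form: within δ of q continuity gives η, and farther away (y
- q)²/δ² ≥ 1 absorbs the trivial bound 2M. Integrated, it turns mean-square convergence into
convergence of integrals of f. -/
theorem exists_quadratic_bound {f : ℝ → ℝ} {q M : ℝ} (hf : ContinuousAt f q)
    (hM : ∀ y, |f y| ≤ M) {η : ℝ} (hη : 0 < η) :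
    ∃ C : ℝ, ∀ y, |f y - f q| ≤ η + C * (y - q) ^ 2 := by
  obtain ⟨δ, hδ, h⟩ := Metric.continuousAt_iff.1 hf η hη
  have hM0 : 0 ≤ M := (abs_nonneg _).trans (hM q)
  refine ⟨2 * M / δ ^ 2, fun y => ?_⟩
  by_cases hy : dist y q < δ
  · have h1 := h hy
    rw [Real.dist_eq] at h1
    have : 0 ≤ 2 * M / δ ^ 2 * (y - q) ^ 2 := by positivity
    linarith
  · rw [Real.dist_eq, not_lt] at hy
    have h1 : δ ^ 2 ≤ (y - q) ^ 2 := by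
      rw [← sq_abs (y - q)]
      exact pow_le_pow_left₀ hδ.le hy 2
    have h2 : 2 * M ≤ 2 * M / δ ^ 2 * (y - q) ^ 2 := by
      rw [div_mul_eq_mul_div, le_div_iff₀ (by positivity)]
      exact mul_le_mul_of_nonneg_left h1 (by positivity)
    have h3 := abs_sub (f y) (f q)
    have h4 := hM y
    have h5 := hM q
    linarith

theorem dist_div_pow_three_le {T : ℝ} (hT : 0 < T) (V : ℝ≥0) :
    dist (V / Real.toNNReal T ^ 3) (Real.toNNReal ((1 / T * smoothCbrt V) ^ 3)) ≤ 1 / T ^ 3 := by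
  have h0 := one_le_smoothCbrt V
  rw [NNReal.dist_eq, Real.coe_toNNReal _ (by positivity), NNReal.coe_div, NNReal.coe_pow,
    Real.coe_toNNReal _ hT.le, mul_pow, one_div, inv_pow]
  have h1 := le_smoothCbrt_pow_three V
  have h2 : smoothCbrt V ^ 3 ≤ (V : ℝ) + 1 := smoothCbrt_pow_three_le V.2
  rw [show (V : ℝ) / T ^ 3 - (T ^ 3)⁻¹ * smoothCbrt V ^ 3
    = -((smoothCbrt V ^ 3 - V) / T ^ 3) by field_simp; ring, abs_neg,
    abs_of_nonneg (div_nonneg (by linarith) (by positivity))]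
  gcongr
  linarith

theorem IsWeakSolution.tendstoWeakStar_rescaled {G : Measure ℝ≥0} {lam : ℝ}
    {F : ℝ → Measure ℝ≥0} (hF : IsWeakSolution lam G F)
    (hlam : 0 < lam) (hG : Integrable (fun v : ℝ≥0 => (v : ℝ)) G) :
    TendstoWeakStar (rescaled F) atTop (Measure.dirac
      (Real.toNNReal ((lam * (∫ v : ℝ≥0, (v : ℝ) ∂G) / 3) ^ 3))) := by
  intro φ
  have l1 := hF.tendsto_exp_mul_integral hlam hG zero_le_one
  have l2 := hF.tendsto_exp_mul_integral hlam hG zero_le_two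
  set c := lam * (∫ v : ℝ≥0, (v : ℝ) ∂G) / 3
  set q := Real.exp (-c) with hq
  have hq1 : Real.exp (-(1 * c)) = q := by rw [one_mul]
  have hq2 : Real.exp (-(2 * c)) = q ^ 2 := by
    rw [hq, ← Real.exp_nat_mul]
    congr 1
    push_cast
    ring
  rw [hq1] at l1
  rw [hq2] at l2
  have hprob : ∀ T, 0 ≤ T → IsProbabilityMeasure (F T) := fun T hT =>
    hF.isProbabilityMeasure hlam.le hG hT
  have hψc : ∀ T : ℝ, Continuous fun V : ℝ≥0 => expCbrt (1 / T) V := fun T =>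
    (continuous_expCbrt _).comp (by fun_prop)
  have hψb : ∀ T : ℝ, 0 ≤ T → ∀ V : ℝ≥0, ‖expCbrt (1 / T) V‖ ≤ 1 := fun T hT V => by
    rw [Real.norm_eq_abs, abs_of_pos (expCbrt_pos _ _)]
    exact expCbrt_le_one (by positivity) V
  have hint : ∀ T : ℝ, 0 ≤ T → Integrable (fun V : ℝ≥0 => (expCbrt (1 / T) V - q) ^ 2) (F T) ∧
      ∫ V : ℝ≥0, (expCbrt (1 / T) V - q) ^ 2 ∂(F T) = ∫ V : ℝ≥0, expCbrt (2 / T) V ∂(F T)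
        - 2 * q * ∫ V : ℝ≥0, expCbrt (1 / T) V ∂(F T) + q ^ 2 := fun T hT => by
    have := hprob T hT
    have i1 : Integrable (fun V : ℝ≥0 => expCbrt (1 / T) V) (F T) :=
      (integrable_const 1).mono' (hψc T).aestronglyMeasurable (Eventually.of_forall (hψb T hT))
    have i2 : Integrable (fun V : ℝ≥0 => expCbrt (2 / T) V) (F T) := by
      refine (integrable_const 1).mono'
        ((continuous_expCbrt _).comp (by fun_prop)).aestronglyMeasurable
        (Eventually.of_forall fun V => ?_)
      rw [Real.norm_eq_abs, abs_of_pos (expCbrt_pos _ _)]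
      exact expCbrt_le_one (by positivity) V
    have e : (fun V : ℝ≥0 => (expCbrt (1 / T) V - q) ^ 2) = fun V : ℝ≥0 =>
        expCbrt (2 / T) V - 2 * q * expCbrt (1 / T) V + q ^ 2 := by
      ext V
      rw [← expCbrt_inv_sq]
      ring
    rw [e]
    have i3 : Integrable (fun V : ℝ≥0 => expCbrt (2 / T) V - 2 * q * expCbrt (1 / T) V) (F T) :=
      i2.sub (i1.const_mul _)
    refine ⟨i3.add (integrable_const _), ?_⟩
    rw [integral_add i3 (integrable_const _), integral_sub i2 (i1.const_mul _), integral_const_mul, integral_const, probReal_univ,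
      one_smul]
  -- The square of exp(-X/T) is exp(-2X/T), so the limits q and q² for k = 1, 2 make the mean square
  -- deviation vanish.
  have hvar : Tendsto (fun T => ∫ V : ℝ≥0, (expCbrt (1 / T) V - q) ^ 2 ∂(F T)) atTop (𝓝 0) := by
    have h := (l2.sub (l1.const_mul (2 * q))).add_const (q ^ 2)
    rw [show q ^ 2 - 2 * q * q + q ^ 2 = 0 by ring] at h
    refine h.congr' ?_
    filter_upwards [eventually_ge_atTop 0] with T hT
    exact (hint T hT).2.symm
  have hφb : ∀ W, |φ W| ≤ ‖φ.toBCF‖ := fun W => φ.toBCF.norm_coe_le_norm W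
  have hφc : Continuous φ := φ.continuous
  -- At y = exp(-X/T) this is φ((X/T)³). The values of the logarithm at y ≤ 0 are harmless: only
  -- boundedness of f and continuity at q > 0 are used.
  set f : ℝ → ℝ := fun y => φ (Real.toNNReal ((-Real.log y) ^ 3)) with hf
  have hfc : ContinuousAt f q := by
    have h1 : ContinuousAt Real.log q := Real.continuousAt_log (Real.exp_pos _).ne'
    exact hφc.continuousAt.comp (continuous_real_toNNReal.continuousAt.comp (h1.neg.pow 3))
  have hfq : f q = φ (Real.toNNReal (c ^ 3)) := by
    simp only [hf, hq, Real.log_exp, neg_neg]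
  rw [integral_dirac, Metric.tendsto_nhds]
  intro δ hδ
  obtain ⟨C, hC⟩ := exists_quadratic_bound hfc (fun y => hφb _) (show 0 < δ / 4 by positivity)
  -- Uniform continuity replaces V/T³ by (X/T)³ for all V at once, since the two differ by at most
  -- 1/T³.
  obtain ⟨r, hr, hφu⟩ := Metric.uniformContinuous_iff.1
    (ZeroAtInftyContinuousMap.uniformContinuous φ) (δ / 4) (by positivity)
  have hsmall : ∀ᶠ T : ℝ in atTop, 1 / T ^ 3 < r :=
    (tendsto_const_nhds.div_atTop (tendsto_pow_atTop three_ne_zero)).eventually (gt_mem_nhds hr)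
  have hlim : ∀ᶠ T : ℝ in atTop,
      C * ∫ V : ℝ≥0, (expCbrt (1 / T) V - q) ^ 2 ∂(F T) < δ / 4 := by
    have := hvar.const_mul C
    rw [mul_zero] at this
    exact this.eventually (gt_mem_nhds (by positivity))
  filter_upwards [hsmall, hlim, eventually_gt_atTop 0] with T h1 h2 hT
  have := hprob T hT.le
  have hmeas : Continuous fun V : ℝ≥0 => V / Real.toNNReal T ^ 3 := by fun_prop
  have hi : Integrable (fun V : ℝ≥0 => φ (V / Real.toNNReal T ^ 3)) (F T) :=
    (integrable_const ‖φ.toBCF‖).mono' (hφc.comp hmeas).aestronglyMeasurable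
      (Eventually.of_forall fun V => hφb _)
  rw [rescaled, integral_map hmeas.aemeasurable hφc.aestronglyMeasurable, Real.dist_eq]
  have e : ∫ V : ℝ≥0, φ (V / Real.toNNReal T ^ 3) ∂(F T) - φ (Real.toNNReal (c ^ 3))
      = ∫ V : ℝ≥0, (φ (V / Real.toNNReal T ^ 3) - φ (Real.toNNReal (c ^ 3))) ∂(F T) := by
    rw [integral_sub hi (integrable_const _), integral_const, probReal_univ, one_smul]
  rw [e]
  have hbound : |∫ V : ℝ≥0, (φ (V / Real.toNNReal T ^ 3) - φ (Real.toNNReal (c ^ 3))) ∂(F T)|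
      ≤ ∫ V : ℝ≥0, (δ / 2 + C * (expCbrt (1 / T) V - q) ^ 2) ∂(F T) := by
    rw [← Real.norm_eq_abs]
    refine norm_integral_le_of_norm_le
      ((integrable_const _).add ((hint T hT.le).1.const_mul C)) (Eventually.of_forall fun V => ?_)
    have a1 := hC (expCbrt (1 / T) V)
    rw [hfq] at a1
    simp only [hf, neg_log_expCbrt] at a1
    have a2 := hφu ((dist_div_pow_three_le hT V).trans_lt h1)
    rw [Real.dist_eq] at a2
    rw [Real.norm_eq_abs]
    have a3 := abs_sub_le (φ (V / Real.toNNReal T ^ 3))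
      (φ (Real.toNNReal ((1 / T * smoothCbrt V) ^ 3))) (φ (Real.toNNReal (c ^ 3)))
    linarith
  rw [integral_add (integrable_const _) ((hint T hT.le).1.const_mul C), integral_const_mul,
    integral_const, probReal_univ, one_smul] at hbound
  linarith

theorem integrable_coe_of_rpow {G : Measure ℝ≥0} [IsFiniteMeasure G] {p : ℝ} (hp : 1 ≤ p)
    (hG : Integrable (fun v : ℝ≥0 => (v : ℝ) ^ p) G) :
    Integrable (fun v : ℝ≥0 => (v : ℝ)) G := by
  refine ((integrable_const (1 : ℝ)).add hG).mono'
    (Continuous.aestronglyMeasurable (by fun_prop)) (Eventually.of_forall fun v => ?_)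
  rw [Real.norm_eq_abs, abs_of_nonneg (NNReal.coe_nonneg v), Pi.add_apply]
  have h0 : 0 ≤ (v : ℝ) ^ p := by positivity
  rcases le_total (v : ℝ) 1 with h | h
  · linarith
  · have := Real.rpow_le_rpow_of_exponent_le h hp
    rw [Real.rpow_one] at this
    linarith

theorem rateConst_pos {U : ℝ} (hU : 0 < U) : 0 < rateConst U := by
  have := Real.pi_pos
  unfold rateConst
  positivity

end

theorem theorem4p1 (U : ℝ) (hU : 0 < U)
    (G : Measure ℝ≥0) [IsFiniteMeasure G]
    (θ : ℝ) (hθ : 0 < θ)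
    (hG : Integrable (fun v : ℝ≥0 => (v : ℝ) ^ (5 / 3 + θ)) G)
    (F : ℝ → Measure ℝ≥0) (hF : IsWeakSolution (rateConst U) G F) :
    (∀ t : ℝ, 0 ≤ t → IsProbabilityMeasure (F t)) ∧
    TendstoWeakStar (rescaled F) atTop
      (Measure.dirac
        (Real.toNNReal (rateConst U ^ 3 / 27 * (∫ v : ℝ≥0, (v : ℝ) ∂G) ^ 3))) := by
  have hv : Integrable (fun v : ℝ≥0 => (v : ℝ)) G := integrable_coe_of_rpow (by linarith) hG
  refine ⟨fun t ht => hF.isProbabilityMeasure (rateConst_pos hU).le hv ht, ?_⟩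
  have h := hF.tendstoWeakStar_rescaled (rateConst_pos hU) hv
  rwa [show (rateConst U * (∫ v : ℝ≥0, (v : ℝ) ∂G) / 3) ^ 3
    = rateConst U ^ 3 / 27 * (∫ v : ℝ≥0, (v : ℝ) ∂G) ^ 3 by ring] at h
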